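/- Proposition (preliminary bound at half density in two dimensions). For a finite set $\Lambda\subset\mathbb Z^2$ let $h_\Lambda$ be the one-electron hamiltonian of the Falicov–Kimball model at $U=\infty$, acting on $L^2(\Lambda)$ by $[h_\Lambda\varphi](x)=2d\,\varphi(x)-\sum_{e:\,x+e\in\Lambda}\varphi(x+e)$ with $d=2$ and $e$ running over the $2d$ unit lattice vectors. Let $E_{\Lambda,N}$ be the ground state energy of $N$ spinless electrons in $\Lambda$, i.e. the sum of the $N$ lowest eigenvalues of $h_\Lambda$ counted with multiplicity, and let $\partial\Lambda$ be the set of sites of $\Lambda$ having a nearest neighbour outside $\Lambda$. Let $\varepsilon_k=2d-2\sum_{i=1}^d\cos k_i$; for a density $n$ let $\varepsilon_F(n)$ be the smallest energy $E$ with $(2\pi)^{-d}\,|\{k\in[-\pi,\pi]^d:\varepsilon_k\le E\}|\ge n$, and let $e(n)=(2\pi)^{-d}\int_{k\in[-\pi,\pi]^d,\ \varepsilon_k<\varepsilon_F(n)}\varepsilon_k\,dk$ be the energy per site of free electrons on $\mathbb Z^d$. For $c\in\mathbb R^2$ put $V(c)=\{k\in\mathbb R^2:\ |k_j-c_j|\le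 \tfrac{1}{7\cdot 2^7}\ (j=1,2),\ \varepsilon_k<\varepsilon_F(1/2)\}$, and let region I be $V(\pi/2,\pi/2)$ and region II be $V(0,\pi)\cup V(0,-\pi)$. Set $$\alpha_1(1/2)=\frac{1}{(2\pi)^d}\cdot\frac{1}{2^8d^4}\,\min\Bigl\{\int_{I}(2d-\varepsilon_k)\,dk,\ \int_{II}(2d-\varepsilon_k)\,dk\Bigr\}\qquad(d=2).$$ Then for every finite $\Lambda\subset\mathbb Z^2$ and every $N$ with $N=\tfrac12|\Lambda|$, $$E_{\Lambda,N}-|\Lambda|\,e(1/2)\ \ge\ \alpha_1(1/2)\,|\partial\Lambda| ,$$ and $\alpha_1(1/2)>10^{-17}$. -/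

import Mathlib

open MeasureTheory

namespace FalicovKimball

/-- The edges issuing from the origin of the lattice `ℤ^d`: the vectors `±e_i`. -/
def edges (d : ℕ) : Finset (Fin d → ℤ) :=
  Finset.univ.image (fun i : Fin d => (Pi.single i 1 : Fin d → ℤ)) ∪
    Finset.univ.image (fun i : Fin d => (Pi.single i (-1) : Fin d → ℤ))

theorem neg_mem_edges {d : ℕ} {v : Fin d → ℤ} (hv : v ∈ edges d) : -v ∈ edges d := by
  simp only [edges, Finset.mem_union, Finset.mem_image, Finset.mem_univ, true_and] at hv ⊢
  rcases hv with ⟨i, rfl⟩ | ⟨i, rfl⟩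
  · exact Or.inr ⟨i, Pi.single_neg i 1⟩
  · exact Or.inl ⟨i, by rw [← Pi.single_neg, neg_neg]⟩

/-- The boundary `∂Λ`: the sites of `Λ` that have a nearest neighbour outside `Λ`. -/
def boundary {d : ℕ} (Λ : Finset (Fin d → ℤ)) : Finset (Fin d → ℤ) :=
  Λ.filter (fun x => ∃ e ∈ edges d, x + e ∉ Λ)

/-- The one-electron hamiltonian `h_Λ` on `L²(Λ)` (hopping amplitude `1`, infinite repulsion), as a
matrix indexed by the sites of `Λ`; `hamiltonian_mulVec` is the usual formula for its action. -/
def hamiltonian {d : ℕ} (Λ : Finset (Fin d → ℤ)) : Matrix Λ Λ ℂ :=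
  fun x y => (if x = y then 2 * (d : ℂ) else 0) -
    (if (y : Fin d → ℤ) - (x : Fin d → ℤ) ∈ edges d then 1 else 0)

theorem hamiltonian_mulVec {d : ℕ} (Λ : Finset (Fin d → ℤ)) (φ : Λ → ℂ) (x : Λ) :
    Matrix.mulVec (hamiltonian Λ) φ x =
      2 * (d : ℂ) * φ x -
        ∑ e ∈ edges d, if h : (x : Fin d → ℤ) + e ∈ Λ then φ ⟨(x : Fin d → ℤ) + e, h⟩ else 0 := by
  have key : ∑ y : Λ, (if (y : Fin d → ℤ) - (x : Fin d → ℤ) ∈ edges d then φ y else 0) =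
      ∑ e ∈ edges d, if h : (x : Fin d → ℤ) + e ∈ Λ then φ ⟨(x : Fin d → ℤ) + e, h⟩ else 0 := by
    rw [← Finset.sum_filter]
    rw [← Finset.sum_filter_of_ne (p := fun e => (x : Fin d → ℤ) + e ∈ Λ)
      (fun e _ he => by
        by_contra hc
        exact he (dif_neg hc))]
    refine Finset.sum_bij (fun y _ => (y : Fin d → ℤ) - (x : Fin d → ℤ)) ?_ ?_ ?_ ?_
    · intro y hy
      simpa using hy
    · intro y _ z _ hyz
      exact Subtype.ext (sub_left_injective hyz)
    · intro e he
      rw [Finset.mem_filter] at he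
      exact ⟨⟨(x : Fin d → ℤ) + e, he.2⟩, by simpa using he.1, by simp⟩
    · intro y _
      simp
  rw [← key]
  simp [Matrix.mulVec, dotProduct, hamiltonian, sub_mul, Finset.sum_sub_distrib]

theorem hamiltonian_isHermitian {d : ℕ} (Λ : Finset (Fin d → ℤ)) :
    (hamiltonian Λ).IsHermitian := by
  ext x y
  have h : ((x : Fin d → ℤ) - (y : Fin d → ℤ) ∈ edges d) ↔
      ((y : Fin d → ℤ) - (x : Fin d → ℤ) ∈ edges d) :=
    ⟨fun hh => by simpa using neg_mem_edges hh, fun hh => by simpa using neg_mem_edges hh⟩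
  simp only [Matrix.conjTranspose_apply, hamiltonian, h, eq_comm (a := y) (b := x), star_sub]
  split_ifs <;> simp

/-- The ground state energy `E_{Λ,N}` of `N` spinless electrons in `Λ`, that is, the sum of the `N`
lowest eigenvalues of `h_Λ`, counted with multiplicity. (`eigenvalues₀` lists the eigenvalues in
decreasing order, so these are the last `N` entries of the list.) -/
noncomputable def groundEnergy {d : ℕ} (Λ : Finset (Fin d → ℤ)) (N : ℕ) : ℝ :=
  ∑ i : Fin (Fintype.card Λ),
    if Fintype.card Λ ≤ (i : ℕ) + N then (hamiltonian_isHermitian Λ).eigenvalues₀ i else 0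

/-- The dispersion relation `ε_k = 2d - 2 ∑ cos k_i`. -/
noncomputable def dispersion {d : ℕ} (k : Fin d → ℝ) : ℝ :=
  2 * (d : ℝ) - 2 * ∑ i, Real.cos (k i)

/-- The Brillouin zone `[-π, π]^d`. -/
def brillouin (d : ℕ) : Set (Fin d → ℝ) := {k | ∀ i, k i ∈ Set.Icc (-Real.pi) Real.pi}

/-- The integrated density of states of free electrons in `ℤ^d`: the number per site of one-electron
levels of energy at most `E`. -/
noncomputable def levelDensity (d : ℕ) (E : ℝ) : ℝ :=
  1 / (2 * Real.pi) ^ d * volume.real {k | k ∈ brillouin d ∧ dispersion k ≤ E}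

/-- The Fermi energy `ε_F(n)` of free electrons in `ℤ^d` at density `n`. -/
noncomputable def fermiEnergy (d : ℕ) (n : ℝ) : ℝ := sInf {E | n ≤ levelDensity d E}

/-- The energy per site `e(n)` of free electrons in `ℤ^d` at density `n`. -/
noncomputable def energyPerSite (d : ℕ) (n : ℝ) : ℝ :=
  1 / (2 * Real.pi) ^ d *
    ∫ k in {k : Fin d → ℝ | k ∈ brillouin d ∧ dispersion k < fermiEnergy d n}, dispersion k

/-- The part inside the half-filling Fermi surface of the closed neighbourhood of `c` on which each
component of `k - c` is at most `1 / (7 · 2^7)` in absolute value. -/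
def innerNbhd (c : Fin 2 → ℝ) : Set (Fin 2 → ℝ) :=
  {k | (∀ j, |k j - c j| ≤ 1 / (7 * 2 ^ 7)) ∧ dispersion k < fermiEnergy 2 (1 / 2)}

/-- Region I, around `(π/2, π/2)`. -/
noncomputable def regionI : Set (Fin 2 → ℝ) := innerNbhd ![Real.pi / 2, Real.pi / 2]

/-- Region II, around the two points `(0, ±π)`. -/
noncomputable def regionII : Set (Fin 2 → ℝ) := innerNbhd ![0, Real.pi] ∪ innerNbhd ![0, -Real.pi]

end FalicovKimball

/-! Put `T = 4 - h_Λ` with eigenvalues `t_j`, and let `τ(k) = 2 cos k₀ + 2 cos k₁` be its symbol.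
Translation by `(π, π)` changes the sign of `τ`, so at half density the Fermi surface is `τ = 0`
(`fermiEnergy_half`). Bounding the ground energy below by `4N - ∑ (t_j)₊` and writing this trace in
momentum space gives an excess of at least `(2π)⁻² ∫ deficit` (`energy_excess_ge`). The deficit is
nonnegative: where `τ > 0` it is at least `τ` times the weight of the plane wave on eigenvectors
with `t_j < 0`, and where `τ < 0` it equals `|τ|` times its weight on those with `t_j > 0`.

To find such weight near the Fermi surface, write `T e_k = τ e_k - w_k`, where the error `w_k` lives
on the boundary. Since `t²/4 - s t` is nonpositive when `0 ≤ s t ≤ 4`, the moments `‖T w‖²/4 - s ⟨w,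
T w⟩` bound the wanted weight from below (`moments_le_spectral_weight`). The sign of `⟨w, T w⟩` is
unknown, but it enters with opposite signs for two nearby momenta on opposite sides of the Fermi
surface and so nearly cancels in the sum (`deficit_add_deficit_ge`).

What remains is `‖T w‖²`. Self-adjointness gives `⟨e_k, T w⟩ = τ ⟨e_k, w⟩ - ‖w‖²`, so a large `w`
forces a large `T w` (`norm_sq_hopping_errorVec_ge`). On a Fermi line the missing bonds can cancel
at a given boundary site, but not on both lines `k₀ ± k₁ = π`, so one line works for the whole of
`Λ` (`exists_fermi_line`). Isolated sites, where `T w` vanishes, are counted separately: they carry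
only eigenvectors with `t_j = 0`. Integrating over a strip along the good line and its translate
across the line gives the bound (`setIntegral_deficit_ge`), whose constant exceeds the claimed one
because region II has integral of order `δ⁴`, `δ = 1/896`. -/

namespace FalicovKimball

/-! ### The hopping symbol and integration over rectangles of momenta. -/

/-- The symbol `2 cos k₀ + 2 cos k₁` of the hopping operator on `ℤ²`. -/
noncomputable def hopSymbol (k : Fin 2 → ℝ) : ℝ := 2 * Real.cos (k 0) + 2 * Real.cos (k 1)

theorem dispersion_eq (k : Fin 2 → ℝ) : dispersion k = 4 - hopSymbol k := by
  simp only [dispersion, hopSymbol, Fin.sum_univ_two]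
  push_cast
  ring

theorem continuous_hopSymbol : Continuous hopSymbol := by
  unfold hopSymbol
  fun_prop

/-- The closed rectangle `[a, b] × [c, d]` as a set of functions on `Fin 2`. -/
def rect (a b c d : ℝ) : Set (Fin 2 → ℝ) := {k | k 0 ∈ Set.Icc a b ∧ k 1 ∈ Set.Icc c d}

theorem rect_eq_preimage (a b c d : ℝ) :
    rect a b c d = MeasurableEquiv.finTwoArrow ⁻¹' (Set.Icc a b ×ˢ Set.Icc c d) := by
  ext k
  simp [rect, MeasurableEquiv.finTwoArrow]
  exact and_and_and_comm

theorem rect_eq_Icc (a b c d : ℝ) : rect a b c d = Set.Icc ![a, c] ![b, d] := by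
  ext k
  simp only [rect, Set.mem_Icc, Set.mem_ofPred_eq, Pi.le_def, Fin.forall_fin_two]
  simp only [Matrix.cons_val_zero, Matrix.cons_val_one]
  exact and_and_and_comm

theorem isCompact_rect (a b c d : ℝ) : IsCompact (rect a b c d) := by
  rw [rect_eq_Icc]
  exact isCompact_Icc

theorem measurableSet_rect (a b c d : ℝ) : MeasurableSet (rect a b c d) :=
  (isCompact_rect a b c d).isClosed.measurableSet

theorem volume_real_rect {a b c d : ℝ} (hab : a ≤ b) (hcd : c ≤ d) :
    volume.real (rect a b c d) = (b - a) * (d - c) := by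
  rw [rect_eq_Icc, measureReal_def, Real.volume_Icc_pi_toReal]
  · simp [Fin.prod_univ_two]
  · intro i
    fin_cases i <;> simpa

theorem brillouin_eq_rect :
    brillouin 2 = rect (-Real.pi) Real.pi (-Real.pi) Real.pi := by
  ext k
  simp only [brillouin, rect, Set.mem_ofPred_eq, Fin.forall_fin_two]

theorem setIntegral_rect {E : Type*} [NormedAddCommGroup E] [NormedSpace ℝ E]
    {a b c d : ℝ} (hab : a ≤ b) (hcd : c ≤ d) (f : (Fin 2 → ℝ) → E)
    (hf : IntegrableOn f (rect a b c d)) :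
    ∫ k in rect a b c d, f k = ∫ x in a..b, ∫ y in c..d, f ![x, y] := by
  have hmp := volume_preserving_finTwoArrow ℝ
  have hemb := (MeasurableEquiv.finTwoArrow (α := ℝ)).measurableEmbedding
  have h1 : ∀ k : Fin 2 → ℝ, f k =
      (fun z : ℝ × ℝ => f ![z.1, z.2]) (MeasurableEquiv.finTwoArrow k) := by
    intro k
    congr 1
    ext i
    fin_cases i <;> rfl
  have h2 : IntegrableOn (fun z : ℝ × ℝ => f ![z.1, z.2]) (Set.Icc a b ×ˢ Set.Icc c d) := by
    rw [← hmp.integrableOn_comp_preimage hemb, ← rect_eq_preimage]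
    exact hf.congr (Filter.Eventually.of_forall h1)
  rw [rect_eq_preimage, integral_congr_ae (Filter.Eventually.of_forall h1),
    hmp.setIntegral_preimage_emb hemb (fun z : ℝ × ℝ => f ![z.1, z.2]), Measure.volume_eq_prod, setIntegral_prod _ h2,
    intervalIntegral.integral_of_le hab, integral_Icc_eq_integral_Ioc]
  refine integral_congr_ae (Filter.Eventually.of_forall fun x => ?_)
  simp only
  rw [intervalIntegral.integral_of_le hcd, integral_Icc_eq_integral_Ioc]

/-- By Fubini this reduces to one periodic variable at a time. -/
theorem setIntegral_brillouin_shift (g : (Fin 2 → ℝ) → ℝ)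
    (hg : IntegrableOn g (brillouin 2))
    (hg' : IntegrableOn (fun k => g (k + fun _ => Real.pi)) (brillouin 2))
    (h0 : ∀ x y, g ![x + 2 * Real.pi, y] = g ![x, y])
    (h1 : ∀ x y, g ![x, y + 2 * Real.pi] = g ![x, y]) :
    ∫ k in brillouin 2, g (k + fun _ => Real.pi) = ∫ k in brillouin 2, g k := by
  have hpi : -Real.pi ≤ Real.pi := by linarith [Real.pi_pos]
  rw [brillouin_eq_rect] at *
  rw [setIntegral_rect hpi hpi _ hg, setIntegral_rect hpi hpi _ hg']
  have e : ∀ x y : ℝ, (![x, y] + fun _ => Real.pi) = ![x + Real.pi, y + Real.pi] := by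
    intro x y
    ext i
    fin_cases i <;> simp
  have hper : ∀ {f : ℝ → ℝ}, Function.Periodic f (2 * Real.pi) →
      ∫ x in -Real.pi..Real.pi, f (x + Real.pi) = ∫ x in -Real.pi..Real.pi, f x := by
    intro f hf
    rw [intervalIntegral.integral_comp_add_right]
    have := hf.intervalIntegral_add_eq (-Real.pi + Real.pi) (-Real.pi)
    convert this using 2 <;> ring
  simp only [e]
  have h2 : ∀ x, ∫ y in -Real.pi..Real.pi, g ![x + Real.pi, y + Real.pi] =
      ∫ y in -Real.pi..Real.pi, g ![x + Real.pi, y] := fun x =>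
    hper (f := fun y => g ![x + Real.pi, y]) (fun y => h1 _ _)
  simp only [h2]
  exact hper (f := fun x => ∫ y in -Real.pi..Real.pi, g ![x, y]) (fun x => by simp only [h0])

theorem volume_real_brillouin : volume.real (brillouin 2) = (2 * Real.pi) ^ 2 := by
  rw [brillouin_eq_rect, volume_real_rect] <;> linarith [Real.pi_pos]

theorem hopSymbol_add_pi (k : Fin 2 → ℝ) : hopSymbol (k + fun _ => Real.pi) = -hopSymbol k := by
  simp [hopSymbol, Real.cos_add_pi]
  ring

theorem indicator_const_congr {α β : Type*} {A : Set α} {B : Set β} {a : α} {b : β}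
    (h : a ∈ A ↔ b ∈ B) (c : ℝ) : A.indicator (fun _ => c) a = B.indicator (fun _ => c) b := by
  by_cases ha : a ∈ A
  · rw [Set.indicator_of_mem ha, Set.indicator_of_mem (h.1 ha)]
  · rw [Set.indicator_of_notMem ha, Set.indicator_of_notMem (mt h.2 ha)]

theorem measurableSet_brillouin : MeasurableSet (brillouin 2) := by
  rw [brillouin_eq_rect]
  exact measurableSet_rect ..

theorem volume_brillouin_ne_top : volume (brillouin 2) ≠ ⊤ := by
  rw [brillouin_eq_rect]
  exact (isCompact_rect ..).measure_ne_top

/-! ### Particle-hole symmetry, the Fermi energy and the energy per site at half density. -/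

/-- The particle-hole symmetry of the level sets of the symbol. -/
theorem volume_real_hopSymbol_neg (s : Set ℝ) (hs : MeasurableSet s) :
    volume.real (brillouin 2 ∩ {k | -hopSymbol k ∈ s}) =
      volume.real (brillouin 2 ∩ {k | hopSymbol k ∈ s}) := by
  have hA : MeasurableSet {k | hopSymbol k ∈ s} := continuous_hopSymbol.measurable hs
  have hB : MeasurableSet {k | -hopSymbol k ∈ s} := continuous_hopSymbol.neg.measurable hs
  have hint : ∀ {A : Set (Fin 2 → ℝ)}, MeasurableSet A →
      IntegrableOn (A.indicator fun _ => (1 : ℝ)) (brillouin 2) := fun hA =>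
    (integrableOn_const volume_brillouin_ne_top).indicator hA
  have hsh : (fun k : Fin 2 → ℝ => {k | hopSymbol k ∈ s}.indicator (fun _ => (1 : ℝ))
      (k + fun _ => Real.pi)) = {k | -hopSymbol k ∈ s}.indicator (fun _ => (1 : ℝ)) := by
    ext k
    refine indicator_const_congr ?_ 1
    change hopSymbol (k + fun _ => Real.pi) ∈ s ↔ -hopSymbol k ∈ s
    rw [hopSymbol_add_pi]
  have key := setIntegral_brillouin_shift ({k | hopSymbol k ∈ s}.indicator fun _ => (1 : ℝ))
    (hint hA) (by rw [hsh]; exact hint hB)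
    (fun x y => indicator_const_congr (by
      change hopSymbol _ ∈ s ↔ hopSymbol _ ∈ s
      simp [hopSymbol, Real.cos_add_two_pi]) 1)
    (fun x y => indicator_const_congr (by
      change hopSymbol _ ∈ s ↔ hopSymbol _ ∈ s
      simp [hopSymbol, Real.cos_add_two_pi]) 1)
  rw [hsh, setIntegral_indicator hB, setIntegral_indicator hA] at key
  simpa using key

theorem levelDensity_eq (E : ℝ) : levelDensity 2 E =
    1 / (2 * Real.pi) ^ 2 * volume.real (brillouin 2 ∩ {k | hopSymbol k ∈ Set.Ici (4 - E)}) := by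
  unfold levelDensity
  congr 3
  ext k
  change _ ∧ dispersion k ≤ E ↔ _ ∧ 4 - E ≤ hopSymbol k
  rw [dispersion_eq]
  constructor <;> rintro ⟨h, h'⟩ <;> exact ⟨h, by linarith⟩

/-- For `E ≥ 4` the set `τ ≥ 4 - E` and its particle-hole image cover the zone and have equal
volume. -/
theorem half_le_levelDensity {E : ℝ} (hE : 4 ≤ E) : 1 / 2 ≤ levelDensity 2 E := by
  rw [levelDensity_eq]
  have hP : (0 : ℝ) < (2 * Real.pi) ^ 2 := by positivity
  have h1 := volume_real_hopSymbol_neg (Set.Ici (4 - E)) measurableSet_Ici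
  have h2 : volume.real (brillouin 2) ≤
      volume.real (brillouin 2 ∩ {k | -hopSymbol k ∈ Set.Ici (4 - E)}) +
      volume.real (brillouin 2 ∩ {k | hopSymbol k ∈ Set.Ici (4 - E)}) := by
    refine (measureReal_mono (fun k hk => ?_) ?_).trans (measureReal_union_le _ _)
    · simp only [Set.mem_union, Set.mem_inter_iff, hk, Set.mem_ofPred_eq, Set.mem_Ici, true_and]
      by_contra! hh
      linarith [hh.1, hh.2]
    · exact measure_ne_top_of_subset (Set.union_subset Set.inter_subset_left
        Set.inter_subset_left) volume_brillouin_ne_top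
  rw [volume_real_brillouin] at h2
  rw [one_div_mul_eq_div, le_div_iff₀ hP]
  linarith

theorem volume_real_hopSymbol_pos_le :
    volume.real (brillouin 2 ∩ {k | 0 < hopSymbol k}) ≤ 1 / 2 * (2 * Real.pi) ^ 2 := by
  have h1 := volume_real_hopSymbol_neg (Set.Ioi 0) measurableSet_Ioi
  have h2 : volume.real (brillouin 2 ∩ {k | -hopSymbol k ∈ Set.Ioi 0}) +
      volume.real (brillouin 2 ∩ {k | hopSymbol k ∈ Set.Ioi 0}) ≤ volume.real (brillouin 2) := by
    rw [← measureReal_union _ _ (measure_ne_top_of_subset Set.inter_subset_left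
      volume_brillouin_ne_top) (measure_ne_top_of_subset Set.inter_subset_left
      volume_brillouin_ne_top)]
    · exact measureReal_mono (Set.union_subset Set.inter_subset_left Set.inter_subset_left)
        volume_brillouin_ne_top
    · rw [Set.disjoint_left]
      rintro k ⟨_, hk⟩ ⟨_, hk'⟩
      simp only [Set.mem_ofPred_eq, Set.mem_Ioi] at hk hk'
      linarith
    · exact measurableSet_brillouin.inter (continuous_hopSymbol.measurable measurableSet_Ioi)
  rw [volume_real_brillouin] at h2
  simp only [Set.mem_Ioi] at h1 h2
  linarith

theorem levelDensity_lt_half {E : ℝ} (hE : E < 4) : levelDensity 2 E < 1 / 2 := by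
  rw [levelDensity_eq]
  have hP : (0 : ℝ) < (2 * Real.pi) ^ 2 := by positivity
  have h1 := volume_real_hopSymbol_neg (Set.Ici (4 - E)) measurableSet_Ici
  -- Strictness comes from an open gap between the two symmetric level sets; it contains `(π/2,
  -- π/2)`, where the symbol vanishes.
  set U : Set (Fin 2 → ℝ) := (Set.univ.pi fun _ => Set.Ioo (-Real.pi) Real.pi) ∩
    {k | |hopSymbol k| < 4 - E} with hU
  have hUo : IsOpen U := (isOpen_set_pi Set.finite_univ fun _ _ => isOpen_Ioo).inter
    (isOpen_lt continuous_hopSymbol.abs continuous_const)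
  have hUsub : U ⊆ brillouin 2 := by
    rintro k ⟨hk, _⟩ i
    exact Set.Ioo_subset_Icc_self (hk i trivial)
  have hUfin : volume U ≠ ⊤ := measure_ne_top_of_subset hUsub volume_brillouin_ne_top
  have hUne : U.Nonempty := by
    refine ⟨fun _ => Real.pi / 2, fun i _ => ⟨?_, ?_⟩, ?_⟩
    · linarith [Real.pi_pos]
    · linarith [Real.pi_pos]
    · simp [hopSymbol, hE]
  have hUpos : 0 < volume.real U :=
    ENNReal.toReal_pos (hUo.measure_pos volume hUne).ne' hUfin
  have hm1 : MeasurableSet (brillouin 2 ∩ {k | -hopSymbol k ∈ Set.Ici (4 - E)}) :=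
    measurableSet_brillouin.inter (continuous_hopSymbol.neg.measurable measurableSet_Ici)
  have hm2 : MeasurableSet (brillouin 2 ∩ {k | hopSymbol k ∈ Set.Ici (4 - E)}) :=
    measurableSet_brillouin.inter (continuous_hopSymbol.measurable measurableSet_Ici)
  have hf : ∀ A : Set (Fin 2 → ℝ), volume (brillouin 2 ∩ A) ≠ ⊤ := fun A =>
    measure_ne_top_of_subset Set.inter_subset_left volume_brillouin_ne_top
  have h2 : volume.real (brillouin 2 ∩ {k | -hopSymbol k ∈ Set.Ici (4 - E)}) +
      volume.real (brillouin 2 ∩ {k | hopSymbol k ∈ Set.Ici (4 - E)}) + volume.real U ≤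
      volume.real (brillouin 2) := by
    rw [← measureReal_union _ hm2 (hf _) (hf _), ← measureReal_union _ hUo.measurableSet _ hUfin]
    · exact measureReal_mono (Set.union_subset (Set.union_subset Set.inter_subset_left
        Set.inter_subset_left) hUsub) volume_brillouin_ne_top
    · rw [Set.disjoint_left]
      rintro k (⟨_, hk⟩ | ⟨_, hk⟩) ⟨_, hk'⟩ <;>
      simp only [Set.mem_ofPred_eq, Set.mem_Ici, abs_lt] at hk hk' <;> linarith
    · exact measure_ne_top_of_subset (Set.union_subset Set.inter_subset_left
        Set.inter_subset_left) volume_brillouin_ne_top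
    · rw [Set.disjoint_left]
      rintro k ⟨_, hk⟩ ⟨_, hk'⟩
      simp only [Set.mem_ofPred_eq, Set.mem_Ici] at hk hk'
      linarith
  rw [volume_real_brillouin] at h2
  rw [one_div_mul_eq_div, div_lt_iff₀ hP]
  linarith

theorem fermiEnergy_half : fermiEnergy 2 (1 / 2) = 4 := by
  have : {E | 1 / 2 ≤ levelDensity 2 E} = Set.Ici 4 := by
    ext E
    simp only [Set.mem_ofPred_eq, Set.mem_Ici]
    exact ⟨fun h => by by_contra! hh; linarith [levelDensity_lt_half hh], half_le_levelDensity⟩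
  rw [fermiEnergy, this, csInf_Ici]

/-- On the Fermi sea `ε = 4 - τ`. As only an upper bound is needed, it suffices that `τ > 0` fills
at most half of the zone; the measure of the Fermi surface itself plays no role. -/
theorem energyPerSite_half_le : energyPerSite 2 (1 / 2) ≤
    2 - 1 / (2 * Real.pi) ^ 2 * ∫ k in brillouin 2, max (hopSymbol k) 0 := by
  have hP : (0 : ℝ) < (2 * Real.pi) ^ 2 := by positivity
  have hset : {k : Fin 2 → ℝ | k ∈ brillouin 2 ∧ dispersion k < fermiEnergy 2 (1 / 2)} =
      brillouin 2 ∩ {k | 0 < hopSymbol k} := by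
    ext k
    simp only [Set.mem_ofPred_eq, Set.mem_inter_iff, fermiEnergy_half, dispersion_eq]
    constructor <;> rintro ⟨h, h'⟩ <;> exact ⟨h, by linarith⟩
  have hpos : MeasurableSet {k | 0 < hopSymbol k} :=
    continuous_hopSymbol.measurable measurableSet_Ioi
  have hmax : (fun k => max (hopSymbol k) 0) = {k | 0 < hopSymbol k}.indicator hopSymbol := by
    ext k
    by_cases h : 0 < hopSymbol k
    · simp [Set.indicator, h, h.le]
    · simp [Set.indicator, h, not_lt.1 h]
  have hc : IntegrableOn hopSymbol (brillouin 2) := by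
    rw [brillouin_eq_rect]
    exact continuous_hopSymbol.continuousOn.integrableOn_compact (isCompact_rect ..)
  rw [energyPerSite, hset, hmax, setIntegral_indicator hpos]
  simp only [dispersion_eq]
  rw [integral_sub, setIntegral_const, smul_eq_mul]
  · have h4 : 1 / (2 * Real.pi) ^ 2 * volume.real (brillouin 2 ∩ {k | 0 < hopSymbol k}) ≤ 1 / 2 := by
      rw [one_div_mul_eq_div, div_le_iff₀ hP]
      exact volume_real_hopSymbol_pos_le
    rw [mul_sub]
    linarith
  · exact integrableOn_const
      (measure_ne_top_of_subset Set.inter_subset_left volume_brillouin_ne_top)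
  · exact hc.mono_set Set.inter_subset_left

/-! ### The integrals over regions I and II and the size of the coefficient. -/

theorem setIntegral_innerNbhd (c : Fin 2 → ℝ) :
    ∫ k in innerNbhd c, (2 * 2 - dispersion k) =
      ∫ k in rect (c 0 - 1 / 896) (c 0 + 1 / 896) (c 1 - 1 / 896) (c 1 + 1 / 896),
        max (hopSymbol k) 0 := by
  have hset : innerNbhd c =
      rect (c 0 - 1 / 896) (c 0 + 1 / 896) (c 1 - 1 / 896) (c 1 + 1 / 896) ∩
        {k | 0 < hopSymbol k} := by
    ext k
    change (∀ j, |k j - c j| ≤ 1 / (7 * 2 ^ 7)) ∧ dispersion k < fermiEnergy 2 (1 / 2) ↔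
      ((_ ≤ _ ∧ _ ≤ _) ∧ (_ ≤ _ ∧ _ ≤ _)) ∧ 0 < hopSymbol k
    rw [fermiEnergy_half, dispersion_eq, Fin.forall_fin_two, abs_le, abs_le]
    rw [show (1 : ℝ) / (7 * 2 ^ 7) = 1 / 896 by norm_num]
    constructor
    · rintro ⟨⟨⟨h1, h2⟩, h3, h4⟩, h5⟩
      exact ⟨⟨⟨by linarith, by linarith⟩, by linarith, by linarith⟩, by linarith⟩
    · rintro ⟨⟨⟨h1, h2⟩, h3, h4⟩, h5⟩
      exact ⟨⟨⟨by linarith, by linarith⟩, by linarith, by linarith⟩, by linarith⟩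
  have hmax : (fun k => max (hopSymbol k) 0) = {k | 0 < hopSymbol k}.indicator hopSymbol := by
    ext k
    by_cases h : 0 < hopSymbol k
    · rw [Set.indicator_of_mem (by exact h), max_eq_left h.le]
    · rw [Set.indicator_of_notMem (by exact h), max_eq_right (not_lt.1 h)]
  have hpos : MeasurableSet {k | 0 < hopSymbol k} :=
    continuous_hopSymbol.measurable measurableSet_Ioi
  rw [hset, hmax, setIntegral_indicator hpos]
  refine integral_congr_ae (Filter.Eventually.of_forall fun k => ?_)
  simp only [dispersion_eq]
  ring

theorem continuous_max_hopSymbol : Continuous fun k => max (hopSymbol k) 0 :=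
  continuous_hopSymbol.max continuous_const

theorem integrableOn_max_hopSymbol (a b c d : ℝ) :
    IntegrableOn (fun k => max (hopSymbol k) 0) (rect a b c d) :=
  continuous_max_hopSymbol.continuousOn.integrableOn_compact (isCompact_rect ..)

/-- With `δ = 1/896`, both cosines are at least `δ/4` on the subsquare `[π/2 - δ, π/2 - δ/2]²`, so
the symbol is at least `δ` there, on area `δ²/4`. This crude bound of order `δ³` suffices, since
region II only gives order `δ⁴`. -/
theorem setIntegral_regionI_ge :
    (1 / 896 : ℝ) ^ 3 / 4 ≤ ∫ k in regionI, (2 * 2 - dispersion k) := by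
  rw [regionI, setIntegral_innerNbhd]
  simp only [Matrix.cons_val_zero, Matrix.cons_val_one]
  set p := Real.pi / 2 with hp
  have hsub : rect (p - 1 / 896) (p - 1 / 1792) (p - 1 / 896) (p - 1 / 1792) ⊆
      rect (p - 1 / 896) (p + 1 / 896) (p - 1 / 896) (p + 1 / 896) := by
    rintro k ⟨⟨h1, h2⟩, h3, h4⟩
    exact ⟨⟨h1, by linarith⟩, h3, by linarith⟩
  have h1 := setIntegral_mono_set
    (integrableOn_max_hopSymbol (p - 1 / 896) (p + 1 / 896) (p - 1 / 896) (p + 1 / 896))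
    (Filter.Eventually.of_forall fun k => le_max_right (hopSymbol k) 0) hsub.eventuallyLE
  refine le_trans ?_ h1
  have hcos : ∀ x ∈ Set.Icc (p - 1 / 896) (p - 1 / 1792), 1 / (4 * 896) ≤ Real.cos x := by
    rintro x ⟨hx1, hx2⟩
    have hsin := Real.mul_le_sin (x := p - x) (by linarith)
      (by linarith [Real.pi_gt_three])
    rw [hp, Real.sin_pi_div_two_sub] at hsin
    refine le_trans ?_ hsin
    have h2 : (1 : ℝ) / 2 ≤ 2 / Real.pi := by
      rw [div_le_div_iff₀ (by norm_num) Real.pi_pos]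
      linarith [Real.pi_le_four]
    have h3 : (1 : ℝ) / 1792 ≤ p - x := by linarith
    calc (1 : ℝ) / (4 * 896) = 1 / 2 * (1 / 1792) := by norm_num
      _ ≤ _ := by gcongr
  have h2 : ∫ k in rect (p - 1 / 896) (p - 1 / 1792) (p - 1 / 896) (p - 1 / 1792),
      (1 / 896 : ℝ) ≤ ∫ k in rect (p - 1 / 896) (p - 1 / 1792) (p - 1 / 896) (p - 1 / 1792),
      max (hopSymbol k) 0 := by
    refine setIntegral_mono_on (integrableOn_const (isCompact_rect ..).measure_ne_top)
      (integrableOn_max_hopSymbol ..) (measurableSet_rect ..) fun k hk => ?_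
    refine le_trans ?_ (le_max_left _ _)
    have h3 := hcos _ hk.1
    have h4 := hcos _ hk.2
    simp only [hopSymbol]
    linarith
  refine le_trans ?_ h2
  rw [setIntegral_const, volume_real_rect (by linarith) (by linarith), smul_eq_mul]
  norm_num

/-- The quadratic bound for `cos u` is exact in the needed direction; only `cos v` costs a quartic
remainder, with twice the constant `5/96` of `Real.cos_bound`. -/
theorem cos_sub_cos_ge {δ u v : ℝ} (hδ1 : δ ≤ 1) (hv : |v| ≤ δ) :
    v ^ 2 - u ^ 2 - 5 / 48 * δ ^ 4 ≤ 2 * Real.cos u - 2 * Real.cos v := by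
  have h1 := Real.one_sub_sq_div_two_le_cos (x := u)
  have h2 := (abs_le.1 (Real.cos_bound (hv.trans hδ1))).2
  have h3 : |v| ^ 4 ≤ δ ^ 4 := by gcongr
  linarith

theorem integral_symm_of_even {f : ℝ → ℝ} (hf : Continuous f) (he : ∀ x, f (-x) = f x) (δ : ℝ) :
    ∫ x in -δ..δ, f x = 2 * ∫ x in 0..δ, f x := by
  rw [← intervalIntegral.integral_add_adjacent_intervals
    (hf.intervalIntegrable (-δ) 0) (hf.intervalIntegrable 0 δ)]
  have : ∫ x in -δ..0, f x = ∫ x in 0..δ, f x := by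
    have := intervalIntegral.integral_comp_neg (a := 0) (b := δ) f
    simp only [he, neg_zero] at this
    exact this.symm
  rw [this]
  ring

theorem integral_vanHove_polynomial (δ : ℝ) :
    ∫ u in 0..δ, ((δ ^ 3 - u ^ 3) / 3 - (u ^ 2 + 5 / 48 * δ ^ 4) * (δ - u)) =
      δ ^ 4 / 6 - 5 / 96 * δ ^ 6 := by
  have : ∀ u : ℝ, (δ ^ 3 - u ^ 3) / 3 - (u ^ 2 + 5 / 48 * δ ^ 4) * (δ - u) =
      2 / 3 * u ^ 3 + (-δ) * u ^ 2 + (5 / 48 * δ ^ 4) * u + (δ ^ 3 / 3 - 5 / 48 * δ ^ 5) := by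
    intro u
    ring
  simp only [this]
  rw [intervalIntegral.integral_add, intervalIntegral.integral_add,
    intervalIntegral.integral_add, intervalIntegral.integral_const_mul,
    intervalIntegral.integral_const_mul, intervalIntegral.integral_const_mul, integral_pow,
    integral_pow, integral_id, intervalIntegral.integral_const, smul_eq_mul]
  · norm_num
    ring
  all_goals exact Continuous.intervalIntegrable (by fun_prop) _ _

/-- The part `v ≤ u` is dropped by positivity; for `v ≥ u` the positive part is bounded below by the
polynomial. -/
theorem integral_max_cos_slice_ge {δ u : ℝ} (hδ1 : δ ≤ 1) (hu0 : 0 ≤ u) (huδ : u ≤ δ) :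
    (δ ^ 3 - u ^ 3) / 3 - (u ^ 2 + 5 / 48 * δ ^ 4) * (δ - u) ≤
      ∫ v in 0..δ, max (2 * Real.cos u - 2 * Real.cos v) 0 := by
  have hFi : ∀ a b, IntervalIntegrable (fun v => max (2 * Real.cos u - 2 * Real.cos v) 0)
      volume a b := fun a b => Continuous.intervalIntegrable (by fun_prop) a b
  rw [← intervalIntegral.integral_add_adjacent_intervals (hFi 0 u) (hFi u δ)]
  have h0 : 0 ≤ ∫ v in 0..u, max (2 * Real.cos u - 2 * Real.cos v) 0 :=
    intervalIntegral.integral_nonneg hu0 fun v _ => le_max_right _ _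
  have h1 : ∫ v in u..δ, (v ^ 2 - (u ^ 2 + 5 / 48 * δ ^ 4)) ≤
      ∫ v in u..δ, max (2 * Real.cos u - 2 * Real.cos v) 0 := by
    refine intervalIntegral.integral_mono_on huδ
      (Continuous.intervalIntegrable (by fun_prop) _ _) (hFi u δ) fun v hv => ?_
    refine le_trans ?_ (le_max_left _ _)
    have := cos_sub_cos_ge (u := u) (v := v) hδ1 (by
      rw [abs_of_nonneg (hu0.trans hv.1)]
      exact hv.2)
    linarith
  have h2 : ∫ v in u..δ, (v ^ 2 - (u ^ 2 + 5 / 48 * δ ^ 4)) =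
      (δ ^ 3 - u ^ 3) / 3 - (u ^ 2 + 5 / 48 * δ ^ 4) * (δ - u) := by
    rw [intervalIntegral.integral_sub (Continuous.intervalIntegrable (by fun_prop) _ _)
      (Continuous.intervalIntegrable (by fun_prop) _ _), integral_pow,
      intervalIntegral.integral_const, smul_eq_mul]
    norm_num
    ring
  linarith

/-- Integral of the positive part near the van Hove points. -/
theorem integral_max_cos_sub_cos_ge {δ : ℝ} (hδ : 0 ≤ δ) (hδ1 : δ ≤ 1) :
    2 / 3 * δ ^ 4 - 5 / 24 * δ ^ 6 ≤
      ∫ u in -δ..δ, ∫ v in -δ..δ, max (2 * Real.cos u - 2 * Real.cos v) 0 := by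
  have hin : ∀ u, ∫ v in -δ..δ, max (2 * Real.cos u - 2 * Real.cos v) 0 =
      2 * ∫ v in 0..δ, max (2 * Real.cos u - 2 * Real.cos v) 0 := fun u =>
    integral_symm_of_even (by fun_prop) (fun v => by rw [Real.cos_neg]) δ
  have hcont : Continuous fun u => ∫ v in 0..δ, max (2 * Real.cos u - 2 * Real.cos v) 0 :=
    intervalIntegral.continuous_parametric_intervalIntegral_of_continuous'
      (by simp only [Function.uncurry_def]; fun_prop) 0 δ
  simp only [hin]
  rw [intervalIntegral.integral_const_mul, integral_symm_of_even hcont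
    (fun x => by simp only [Real.cos_neg])]
  have hpoly : IntervalIntegrable
      (fun u => (δ ^ 3 - u ^ 3) / 3 - (u ^ 2 + 5 / 48 * δ ^ 4) * (δ - u)) volume 0 δ :=
    Continuous.intervalIntegrable (by fun_prop) _ _
  have hmono := intervalIntegral.integral_mono_on hδ hpoly (hcont.intervalIntegrable 0 δ)
    fun u hu => integral_max_cos_slice_ge hδ1 hu.1 hu.2
  rw [integral_vanHove_polynomial] at hmono
  linarith

theorem cos_eq_neg_cos_sub {c : ℝ} (hc : c = Real.pi ∨ c = -Real.pi) (y : ℝ) :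
    Real.cos y = -Real.cos (y - c) := by
  rcases hc with rfl | rfl
  · rw [Real.cos_sub_pi, neg_neg]
  · rw [sub_neg_eq_add, Real.cos_add_pi, neg_neg]

theorem setIntegral_vanHove {c : ℝ} (hc : c = Real.pi ∨ c = -Real.pi) :
    ∫ k in innerNbhd ![0, c], (2 * 2 - dispersion k) =
      ∫ u in -(1 / 896)..(1 / 896), ∫ v in -(1 / 896)..(1 / 896),
        max (2 * Real.cos u - 2 * Real.cos v) 0 := by
  rw [setIntegral_innerNbhd]
  simp only [Matrix.cons_val_zero, Matrix.cons_val_one]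
  rw [setIntegral_rect (by linarith) (by linarith) _ (integrableOn_max_hopSymbol ..)]
  norm_num
  refine intervalIntegral.integral_congr fun u _ => ?_
  simp only [hopSymbol, Matrix.cons_val_zero, Matrix.cons_val_one]
  have := intervalIntegral.integral_comp_sub_right
    (a := c - 1 / 896) (b := c + 1 / 896)
    (fun v => max (2 * Real.cos u - 2 * Real.cos v) 0) c
  norm_num at this
  rw [← this]
  refine intervalIntegral.integral_congr fun y _ => ?_
  rw [cos_eq_neg_cos_sub hc y]
  congr 1
  ring

theorem measurableSet_innerNbhd (c : Fin 2 → ℝ) : MeasurableSet (innerNbhd c) := by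
  have hd : Continuous fun k : Fin 2 → ℝ => dispersion k := by
    simp only [dispersion_eq]
    exact continuous_const.sub continuous_hopSymbol
  have h1 : IsClosed {k : Fin 2 → ℝ | ∀ j, |k j - c j| ≤ 1 / (7 * 2 ^ 7)} := by
    rw [Set.ofPred_forall]
    exact isClosed_iInter fun j => isClosed_le (by fun_prop) continuous_const
  exact h1.measurableSet.inter (isOpen_lt hd continuous_const).measurableSet

theorem integrableOn_innerNbhd (c : Fin 2 → ℝ) :
    IntegrableOn (fun k => 2 * 2 - dispersion k) (innerNbhd c) := by
  have hd : Continuous fun k : Fin 2 → ℝ => 2 * 2 - dispersion k := by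
    simp only [dispersion_eq]
    exact continuous_const.sub (continuous_const.sub continuous_hopSymbol)
  refine (hd.continuousOn.integrableOn_compact
    (isCompact_rect (c 0 - 1) (c 0 + 1) (c 1 - 1) (c 1 + 1))).mono_set ?_
  rintro k ⟨hk, -⟩
  have h0 := abs_le.1 (hk 0)
  have h1 := abs_le.1 (hk 1)
  norm_num at h0 h1
  exact ⟨⟨by linarith, by linarith⟩, by linarith, by linarith⟩

theorem setIntegral_regionII : ∫ k in regionII, (2 * 2 - dispersion k) =
    2 * ∫ u in -(1 / 896)..(1 / 896), ∫ v in -(1 / 896)..(1 / 896),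
        max (2 * Real.cos u - 2 * Real.cos v) 0 := by
  rw [regionII, setIntegral_union _ (measurableSet_innerNbhd _) (integrableOn_innerNbhd _)
    (integrableOn_innerNbhd _), setIntegral_vanHove (.inl rfl), setIntegral_vanHove (.inr rfl)]
  · ring
  · rw [Set.disjoint_left]
    rintro k ⟨hk, -⟩ ⟨hk', -⟩
    have h0 := abs_le.1 (hk 1)
    have h1 := abs_le.1 (hk' 1)
    simp only [Matrix.cons_val_one] at h0 h1
    norm_num at h0 h1
    linarith [Real.pi_gt_three]

theorem setIntegral_regionII_ge :
    2 * (2 / 3 * (1 / 896) ^ 4 - 5 / 24 * (1 / 896) ^ 6) ≤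
      ∫ k in regionII, (2 * 2 - dispersion k) := by
  rw [setIntegral_regionII]
  have := integral_max_cos_sub_cos_ge (δ := 1 / 896) (by norm_num) (by norm_num)
  linarith

/-- Around `(0, ±π)` the symbol is at most `2 - 2 cos v ≤ v² ≤ δ²` on a square of area `4δ²`. This
caps the minimum that defines the coefficient. -/
theorem setIntegral_regionII_le :
    ∫ k in regionII, (2 * 2 - dispersion k) ≤ 8 * (1 / 896) ^ 4 := by
  have hv : ∀ c, c = Real.pi ∨ c = -Real.pi →
      ∫ k in innerNbhd ![0, c], (2 * 2 - dispersion k) ≤ 4 * (1 / 896) ^ 4 := by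
    intro c hc
    rw [setIntegral_innerNbhd]
    simp only [Matrix.cons_val_zero, Matrix.cons_val_one]
    have h2 : ∫ k in rect (0 - 1 / 896) (0 + 1 / 896) (c - 1 / 896) (c + 1 / 896),
        max (hopSymbol k) 0 ≤
        ∫ k in rect (0 - 1 / 896) (0 + 1 / 896) (c - 1 / 896) (c + 1 / 896),
        ((1 / 896) ^ 2 : ℝ) := by
      refine setIntegral_mono_on (integrableOn_max_hopSymbol ..)
        (integrableOn_const (isCompact_rect ..).measure_ne_top) (measurableSet_rect ..)
        fun k hk => max_le ?_ (by norm_num)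
      have h3 : (k 1 - c) ^ 2 ≤ (1 / 896) ^ 2 :=
        sq_le_sq' (by linarith [hk.2.1]) (by linarith [hk.2.2])
      have h4 := Real.one_sub_sq_div_two_le_cos (x := k 1 - c)
      have h5 := Real.cos_le_one (k 0)
      simp only [hopSymbol]
      rw [cos_eq_neg_cos_sub hc (k 1)]
      linarith
    refine h2.trans ?_
    rw [setIntegral_const, volume_real_rect (by linarith) (by linarith), smul_eq_mul]
    ring_nf
    norm_num
  rw [regionII, setIntegral_union _ (measurableSet_innerNbhd _) (integrableOn_innerNbhd _)
    (integrableOn_innerNbhd _)]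
  · linarith [hv _ (.inl rfl), hv _ (.inr rfl)]
  · rw [Set.disjoint_left]
    rintro k ⟨hk, -⟩ ⟨hk', -⟩
    have h0 := abs_le.1 (hk 1)
    have h1 := abs_le.1 (hk' 1)
    simp only [Matrix.cons_val_one] at h0 h1
    norm_num at h0 h1
    linarith [Real.pi_gt_three]

/-- There is little room: `(4/3) · 896⁻⁴ / (40 · 2¹²)` is about `1.26 · 10⁻¹⁷`, so the leading
coefficient of the region II integral must be sharp. -/
theorem coefficient_gt :
    1 / (2 * Real.pi) ^ 2 * (1 / (2 ^ 8 * 2 ^ 4)) *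
        min (∫ k in regionI, (2 * 2 - dispersion k))
          (∫ k in regionII, (2 * 2 - dispersion k)) >
      1 / (10 : ℝ) ^ 17 := by
  have hm : 2 * (2 / 3 * (1 / 896 : ℝ) ^ 4 - 5 / 24 * (1 / 896) ^ 6) ≤
      min (∫ k in regionI, (2 * 2 - dispersion k)) (∫ k in regionII, (2 * 2 - dispersion k)) :=
    le_min (le_trans (by norm_num) setIntegral_regionI_ge) setIntegral_regionII_ge
  have hP : (2 * Real.pi) ^ 2 < 40 := by
    have := Real.pi_lt_d2
    have := Real.pi_pos
    nlinarith
  have hP' : 1 / 40 < 1 / (2 * Real.pi) ^ 2 :=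
    one_div_lt_one_div_of_lt (by positivity) hP
  refine lt_of_lt_of_le ?_ (mul_le_mul_of_nonneg_left hm (by positivity))
  refine lt_trans ?_ (mul_lt_mul_of_pos_right (mul_lt_mul_of_pos_right hP' (by norm_num))
    (by norm_num))
  norm_num

/-! ### Spectral weight of an approximate eigenvector. -/

section Spectral

variable {ι E : Type*} [Fintype ι] [NormedAddCommGroup E] [InnerProductSpace ℂ E]

theorem sum_eigenvalue_mul_sq_norm_inner (b : OrthonormalBasis ι ℂ E) (t : ι → ℝ) (T : E → E)
    (hT : ∀ j v, inner ℂ (b j) (T v) = t j * inner ℂ (b j) v) (v : E) :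
    ∑ j, t j * ‖inner ℂ (b j) v‖ ^ 2 = (inner ℂ v (T v)).re := by
  rw [← b.sum_inner_mul_inner v (T v), Complex.re_sum]
  refine Finset.sum_congr rfl fun j _ => ?_
  rw [hT, ← inner_conj_symm v (b j), mul_left_comm, Complex.conj_mul', ← Complex.ofReal_pow,
    ← Complex.ofReal_mul, Complex.ofReal_re]

theorem sum_sq_eigenvalue_mul_sq_norm_inner (b : OrthonormalBasis ι ℂ E) (t : ι → ℝ) (T : E → E)
    (hT : ∀ j v, inner ℂ (b j) (T v) = t j * inner ℂ (b j) v) (v : E) :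
    ∑ j, t j ^ 2 * ‖inner ℂ (b j) v‖ ^ 2 = ‖T v‖ ^ 2 := by
  rw [← b.sum_sq_norm_inner_right]
  refine Finset.sum_congr rfl fun j _ => ?_
  rw [hT, norm_mul, mul_pow, Complex.norm_real, Real.norm_eq_abs, sq_abs]

/-- An approximate eigenvector `e` with eigenvalue near `0` and error `w` has weight on both
spectral subspaces, controlled by the first two moments of `w`. -/
theorem moments_le_spectral_weight (b : OrthonormalBasis ι ℂ E) (t : ι → ℝ) (T : E → E)
    (hT : ∀ j v, inner ℂ (b j) (T v) = t j * inner ℂ (b j) v) (ht : ∀ j, |t j| ≤ 4)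
    {τ s : ℝ} (hτ : |τ| ≤ 1 / 8) (hs : s = 1 ∨ s = -1) {e w : E} (he : T e = (τ : ℂ) • e - w) :
    (‖T w‖ ^ 2 / 4 - s * (inner ℂ w (T w)).re) / 144 ≤
      ∑ j, if s * t j < 0 then ‖inner ℂ (b j) e‖ ^ 2 else 0 := by
  rw [← sum_eigenvalue_mul_sq_norm_inner b t T hT, ← sum_sq_eigenvalue_mul_sq_norm_inner b t T hT,
    Finset.sum_div, Finset.mul_sum, ← Finset.sum_sub_distrib, Finset.sum_div]
  refine Finset.sum_le_sum fun j _ => ?_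
  have hw : inner ℂ (b j) w = ((τ - t j : ℝ) : ℂ) * inner ℂ (b j) e := by
    have : w = (τ : ℂ) • e - T e := by rw [he]; abel
    rw [this, inner_sub_right, inner_smul_right, hT]
    push_cast
    ring
  have hn : ‖inner ℂ (b j) w‖ ^ 2 = (τ - t j) ^ 2 * ‖inner ℂ (b j) e‖ ^ 2 := by
    rw [hw, norm_mul, mul_pow, Complex.norm_real, Real.norm_eq_abs, sq_abs]
  obtain ⟨h1, h2⟩ := abs_le.1 (ht j)
  obtain ⟨h3, h4⟩ := abs_le.1 hτ
  -- The constant 144 is `8 · 18`: `t²/4 - s t ≤ 8` for `|t| ≤ 4`, and `(4 + 1/8)² ≤ 18`. Indices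
  -- with `s t ≥ 0` contribute a nonpositive amount and may be discarded.
  have h18 : (τ - t j) ^ 2 ≤ 18 := by nlinarith
  set X := ‖inner ℂ (b j) e‖ ^ 2 with hX
  have hX0 : 0 ≤ X := by positivity
  have hq : t j ^ 2 * ‖inner ℂ (b j) w‖ ^ 2 / 4 - s * (t j * ‖inner ℂ (b j) w‖ ^ 2) =
      (t j ^ 2 / 4 - s * t j) * ((τ - t j) ^ 2 * X) := by
    rw [hn]
    ring
  rw [hq]
  have hY0 : 0 ≤ (τ - t j) ^ 2 * X := by positivity
  have hY : (τ - t j) ^ 2 * X ≤ 18 * X := mul_le_mul_of_nonneg_right h18 hX0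
  split_ifs with h
  · have h8 : t j ^ 2 / 4 - s * t j ≤ 8 := by rcases hs with rfl | rfl <;> nlinarith
    have h0 : 0 ≤ t j ^ 2 / 4 - s * t j := by nlinarith
    nlinarith
  · have h0 : t j ^ 2 / 4 - s * t j ≤ 0 := by rcases hs with rfl | rfl <;> nlinarith
    have := mul_nonpos_of_nonpos_of_nonneg h0 hY0
    linarith

end Spectral

/-! ### Plane waves and their orthogonality over the Brillouin zone. -/

section PlaneWave

/-- The plane wave `x ↦ exp(i k·x)`. -/
noncomputable def planeWave (k : Fin 2 → ℝ) (x : Fin 2 → ℤ) : ℂ :=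
  Complex.exp (Complex.I * ((k 0 * x 0 + k 1 * x 1 : ℝ) : ℂ))

theorem planeWave_add (k : Fin 2 → ℝ) (x y : Fin 2 → ℤ) :
    planeWave k (x + y) = planeWave k x * planeWave k y := by
  rw [planeWave, planeWave, planeWave, ← Complex.exp_add]
  congr 1
  simp only [Pi.add_apply]
  push_cast
  ring

theorem norm_planeWave (k : Fin 2 → ℝ) (x : Fin 2 → ℤ) : ‖planeWave k x‖ = 1 := by
  rw [planeWave, mul_comm, Complex.norm_exp_ofReal_mul_I]

theorem conj_planeWave (k : Fin 2 → ℝ) (x : Fin 2 → ℤ) :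
    (starRingEnd ℂ) (planeWave k x) = planeWave k (-x) := by
  rw [planeWave, planeWave, ← Complex.exp_conj]
  congr 1
  simp only [map_mul, Complex.conj_I, Complex.conj_ofReal, Pi.neg_apply]
  push_cast
  ring

theorem planeWave_zero (k : Fin 2 → ℝ) : planeWave k 0 = 1 := by simp [planeWave]

theorem conj_planeWave_mul (k : Fin 2 → ℝ) (x : Fin 2 → ℤ) :
    (starRingEnd ℂ) (planeWave k x) * planeWave k x = 1 := by
  rw [conj_planeWave, ← planeWave_add, neg_add_cancel, planeWave_zero]

theorem continuous_planeWave (x : Fin 2 → ℤ) : Continuous fun k => planeWave k x := by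
  unfold planeWave
  fun_prop

theorem edges_two : edges 2 = {![1, 0], ![0, 1], ![-1, 0], ![0, -1]} := by decide

theorem sum_edges_two {M : Type*} [AddCommMonoid M] (f : (Fin 2 → ℤ) → M) :
    ∑ e ∈ edges 2, f e = f ![1, 0] + (f ![0, 1] + (f ![-1, 0] + f ![0, -1])) := by
  rw [edges_two, Finset.sum_insert (by decide), Finset.sum_insert (by decide),
    Finset.sum_insert (by decide), Finset.sum_singleton]

theorem sum_planeWave_edges (k : Fin 2 → ℝ) : ∑ e ∈ edges 2, planeWave k e = hopSymbol k := by
  rw [sum_edges_two]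
  simp only [planeWave, hopSymbol, Complex.ofReal_add, Complex.ofReal_mul, Complex.ofReal_cos,
    Complex.cos, Complex.ofReal_ofNat]
  simp
  ring_nf

theorem integral_exp_int_mul (n : ℤ) :
    ∫ x in -Real.pi..Real.pi, Complex.exp (Complex.I * ((x * n : ℝ) : ℂ)) =
      if n = 0 then 2 * (Real.pi : ℂ) else 0 := by
  split_ifs with h
  · subst h
    simp
    ring
  · have hc : Complex.I * n ≠ 0 := mul_ne_zero Complex.I_ne_zero (Int.cast_ne_zero.2 h)
    have := integral_exp_mul_complex (a := -Real.pi) (b := Real.pi) hc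
    have h2 : ∀ x : ℝ, Complex.I * ((x * n : ℝ) : ℂ) = Complex.I * n * x := by
      intro x
      push_cast
      ring
    simp only [h2]
    rw [this, div_eq_zero_iff]
    left
    rw [sub_eq_zero, Complex.exp_eq_exp_iff_exists_int]
    refine ⟨n, ?_⟩
    push_cast
    ring

theorem setIntegral_planeWave (z : Fin 2 → ℤ) :
    ∫ k in brillouin 2, planeWave k z = if z = 0 then ((2 * Real.pi) ^ 2 : ℂ) else 0 := by
  have hpi : -Real.pi ≤ Real.pi := by linarith [Real.pi_pos]
  rw [brillouin_eq_rect, setIntegral_rect hpi hpi _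
    ((continuous_planeWave z).continuousOn.integrableOn_compact (isCompact_rect ..))]
  have h : ∀ x y : ℝ, planeWave ![x, y] z = Complex.exp (Complex.I * ((x * z 0 : ℝ) : ℂ)) *
      Complex.exp (Complex.I * ((y * z 1 : ℝ) : ℂ)) := by
    intro x y
    rw [planeWave, ← Complex.exp_add]
    congr 1
    simp only [Matrix.cons_val_zero, Matrix.cons_val_one]
    push_cast
    ring
  simp only [h, intervalIntegral.integral_const_mul, intervalIntegral.integral_mul_const,
    integral_exp_int_mul]
  have hz : z = 0 ↔ z 0 = 0 ∧ z 1 = 0 := by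
    rw [funext_iff, Fin.forall_fin_two]
    rfl
  by_cases h0 : z 0 = 0 <;> by_cases h1 : z 1 = 0 <;> simp [h0, h1, hz]
  ring

end PlaneWave

/-! ### The hopping operator on `Λ` and its momentum representation. -/

section Hopping

variable (Λ : Finset (Fin 2 → ℤ))

/-- The hopping operator `4 - h_Λ` on `L²(Λ)`. -/
noncomputable def hopping (v : EuclideanSpace ℂ Λ) : EuclideanSpace ℂ Λ :=
  WithLp.toLp 2 fun x => ∑ e ∈ edges 2,
    if h : (x : Fin 2 → ℤ) + e ∈ Λ then v ⟨(x : Fin 2 → ℤ) + e, h⟩ else 0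

/-- The orthonormal eigenvectors of `h_Λ`. -/
noncomputable def eigenbasis : OrthonormalBasis Λ ℂ (EuclideanSpace ℂ Λ) :=
  (hamiltonian_isHermitian Λ).eigenvectorBasis

/-- The eigenvalues of the hopping operator. -/
noncomputable def hopEigenvalue (j : Λ) : ℝ := 4 - (hamiltonian_isHermitian Λ).eigenvalues j

/-- The plane wave restricted to `Λ`. -/
noncomputable def waveVec (k : Fin 2 → ℝ) : EuclideanSpace ℂ Λ :=
  WithLp.toLp 2 fun x => planeWave k x

theorem hopping_eigenbasis (j : Λ) :
    hopping Λ (eigenbasis Λ j) = (hopEigenvalue Λ j : ℂ) • eigenbasis Λ j := by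
  ext x
  have h := congrFun ((hamiltonian_isHermitian Λ).mulVec_eigenvectorBasis j) x
  rw [hamiltonian_mulVec] at h
  simp only [Pi.smul_apply, Complex.real_smul] at h
  simp only [hopping, eigenbasis, hopEigenvalue, PiLp.smul_apply, smul_eq_mul]
  push_cast at h ⊢
  rw [sub_mul, ← h]
  ring

theorem hopping_apply (v : EuclideanSpace ℂ Λ) (x : Λ) :
    hopping Λ v x = ∑ y : Λ, if (y : Fin 2 → ℤ) - x ∈ edges 2 then v y else 0 := by
  have h := hamiltonian_mulVec Λ v x
  have h2 : hopping Λ v x = 2 * ((2 : ℕ) : ℂ) * v x - Matrix.mulVec (hamiltonian Λ) v x := by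
    rw [h]
    simp only [hopping]
    ring
  rw [h2]
  simp [Matrix.mulVec, dotProduct, hamiltonian, sub_mul, Finset.sum_sub_distrib]

theorem inner_hopping (v w : EuclideanSpace ℂ Λ) :
    inner ℂ v (hopping Λ w) = inner ℂ (hopping Λ v) w := by
  simp only [PiLp.inner_apply, hopping_apply, RCLike.inner_apply, map_sum, Finset.mul_sum,
    Finset.sum_mul]
  rw [Finset.sum_comm]
  refine Finset.sum_congr rfl fun y _ => Finset.sum_congr rfl fun x _ => ?_
  have h : ((x : Fin 2 → ℤ) - y ∈ edges 2) ↔ ((y : Fin 2 → ℤ) - x ∈ edges 2) :=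
    ⟨fun hh => by simpa using neg_mem_edges hh, fun hh => by simpa using neg_mem_edges hh⟩
  by_cases hh : (y : Fin 2 → ℤ) - x ∈ edges 2 <;> simp [hh, h]

theorem inner_eigenbasis_hopping (j : Λ) (v : EuclideanSpace ℂ Λ) :
    inner ℂ (eigenbasis Λ j) (hopping Λ v) = hopEigenvalue Λ j * inner ℂ (eigenbasis Λ j) v := by
  rw [inner_hopping, hopping_eigenbasis, inner_smul_left, Complex.conj_ofReal]

theorem norm_hopping_apply_le (v : EuclideanSpace ℂ Λ) {C : ℝ} (hC : ∀ x, ‖v x‖ ≤ C) (x : Λ) :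
    ‖hopping Λ v x‖ ≤ 4 * C := by
  have hC0 : 0 ≤ C := (norm_nonneg _).trans (hC x)
  have h4 : (edges 2).card = 4 := by decide
  refine (norm_sum_le_of_le (f := fun e => if h : (x : Fin 2 → ℤ) + e ∈ Λ then
    v ⟨(x : Fin 2 → ℤ) + e, h⟩ else 0) (edges 2) (n := fun _ => C) fun e _ => ?_).trans ?_
  · split_ifs
    · exact hC _
    · simpa
  · simp [h4]

/-- Compare both sides of the eigenvalue equation at a site where the eigenvector has maximal
modulus; each site has four neighbours. -/
theorem abs_hopEigenvalue_le (j : Λ) : |hopEigenvalue Λ j| ≤ 4 := by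
  obtain ⟨x, -, hx⟩ := Finset.exists_max_image Finset.univ (fun x => ‖eigenbasis Λ j x‖)
    ⟨j, Finset.mem_univ j⟩
  have h := norm_hopping_apply_le Λ (eigenbasis Λ j) (fun y => hx y (Finset.mem_univ y)) x
  rw [hopping_eigenbasis, PiLp.smul_apply, norm_smul, Complex.norm_real, Real.norm_eq_abs] at h
  have hpos : 0 < ‖eigenbasis Λ j x‖ := by
    by_contra! h0
    have hz : eigenbasis Λ j = 0 := by
      ext y
      exact norm_le_zero_iff.1 ((hx y (Finset.mem_univ y)).trans h0)
    have h1 := (eigenbasis Λ).orthonormal.1 j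
    rw [hz, norm_zero] at h1
    exact zero_ne_one h1
  exact le_of_mul_le_mul_right h hpos

theorem continuous_inner_waveVec (v : EuclideanSpace ℂ Λ) :
    Continuous fun k => inner ℂ v (waveVec Λ k) := by
  simp only [PiLp.inner_apply, waveVec, RCLike.inner_apply]
  exact continuous_finsetSum _ fun x _ => (continuous_planeWave _).mul continuous_const

/-- The expectation of the hopping operator in momentum space. -/
theorem setIntegral_hopSymbol_mul (v : EuclideanSpace ℂ Λ) :
    ∫ k in brillouin 2, hopSymbol k * ‖inner ℂ v (waveVec Λ k)‖ ^ 2 =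
      (2 * Real.pi) ^ 2 * (inner ℂ v (hopping Λ v)).re := by
  -- Everything is a finite sum of characters; integration keeps only the terms `y = x + e`, which
  -- are the matrix elements of the hopping.
  have hexp : ∀ k, ((hopSymbol k * ‖inner ℂ v (waveVec Λ k)‖ ^ 2 : ℝ) : ℂ) =
      ∑ x : Λ, ∑ y : Λ, ∑ e ∈ edges 2, (starRingEnd ℂ (v x) * v y) *
        planeWave k ((x : Fin 2 → ℤ) + e - y) := by
    intro k
    push_cast
    rw [← Complex.mul_conj', ← sum_planeWave_edges]
    simp only [PiLp.inner_apply, waveVec, RCLike.inner_apply, map_sum, map_mul, Complex.conj_conj,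
      conj_planeWave]
    rw [Finset.sum_mul_sum, Finset.mul_sum]
    refine Finset.sum_congr rfl fun x _ => ?_
    rw [Finset.mul_sum]
    refine Finset.sum_congr rfl fun y _ => ?_
    rw [Finset.sum_mul]
    refine Finset.sum_congr rfl fun e _ => ?_
    rw [sub_eq_add_neg, planeWave_add, planeWave_add]
    ring
  have hint : ∀ z, IntegrableOn (fun k => planeWave k z) (brillouin 2) := fun z => by
    rw [brillouin_eq_rect]
    exact (continuous_planeWave z).continuousOn.integrableOn_compact (isCompact_rect ..)
  have hC : ((∫ k in brillouin 2, hopSymbol k * ‖inner ℂ v (waveVec Λ k)‖ ^ 2 : ℝ) : ℂ) =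
      ((2 * Real.pi) ^ 2 : ℂ) * inner ℂ v (hopping Λ v) := by
    rw [← integral_complex_ofReal]
    simp only [hexp]
    rw [integral_finsetSum _ fun x _ => integrable_finsetSum _ fun y _ =>
      integrable_finsetSum _ fun e _ => (hint _).const_mul _]
    simp only [PiLp.inner_apply, RCLike.inner_apply]
    rw [Finset.mul_sum]
    refine Finset.sum_congr rfl fun x _ => ?_
    rw [integral_finsetSum _ fun y _ =>
      integrable_finsetSum _ fun e _ => (hint _).const_mul _]
    rw [hopping_apply, Finset.sum_mul, Finset.mul_sum]
    refine Finset.sum_congr rfl fun y _ => ?_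
    rw [integral_finsetSum _ fun e _ => (hint _).const_mul _]
    simp only [integral_const_mul, setIntegral_planeWave]
    have : ∀ e : Fin 2 → ℤ, (x : Fin 2 → ℤ) + e - y = 0 ↔ (y : Fin 2 → ℤ) - x = e := by
      intro e
      rw [sub_eq_zero, sub_eq_iff_eq_add', eq_comm]
    simp only [this, mul_ite, mul_zero, Finset.sum_ite_eq]
    split_ifs
    · ring
    · ring
  have := congrArg Complex.re hC
  rw [Complex.ofReal_re] at this
  rw [this]
  have h2 : ((2 * Real.pi) ^ 2 : ℂ) = (((2 * Real.pi) ^ 2 : ℝ) : ℂ) := by push_cast; ring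
  rw [h2, Complex.re_ofReal_mul]

end Hopping

/-! ### The energy excess as an integral of a nonnegative deficit. -/

section Deficit

variable (Λ : Finset (Fin 2 → ℤ))

theorem sum_last_const {n N : ℕ} (h : N ≤ n) (c : ℝ) :
    ∑ i : Fin n, (if n ≤ (i : ℕ) + N then c else 0) = N * c := by
  have h1 := Fin.sum_univ_eq_sum_range (fun i => if n ≤ i + N then c else 0) n
  rw [h1, ← Finset.sum_filter, Finset.sum_const, nsmul_eq_mul]
  congr 2
  have : (Finset.range n).filter (fun i => n ≤ i + N) = Finset.Ico (n - N) n := by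
    ext i
    simp only [Finset.mem_filter, Finset.mem_range, Finset.mem_Ico]
    omega
  rw [this, Nat.card_Ico]
  omega

/-- Termwise: an occupied level `4 - t` is at least `4 - t₊`, and an empty one contributes `0 ≥
-t₊`. -/
theorem groundEnergy_ge {N : ℕ} (hN : N ≤ Λ.card) :
    4 * (N : ℝ) - ∑ j, max (hopEigenvalue Λ j) 0 ≤ groundEnergy Λ N := by
  have h1 : ∑ j, max (hopEigenvalue Λ j) 0 = ∑ i : Fin (Fintype.card Λ),
      max (4 - (hamiltonian_isHermitian Λ).eigenvalues₀ i) 0 := by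
    simp only [hopEigenvalue, Matrix.IsHermitian.eigenvalues]
    exact Equiv.sum_comp (Fintype.equivOfCardEq (Fintype.card_fin _)).symm
      fun i => max (4 - (hamiltonian_isHermitian Λ).eigenvalues₀ i) 0
  rw [h1, mul_comm, ← sum_last_const (n := Fintype.card Λ) (by simpa using hN) 4,
    ← Finset.sum_sub_distrib, groundEnergy]
  refine Finset.sum_le_sum fun i _ => ?_
  split_ifs
  · linarith [le_max_left (4 - (hamiltonian_isHermitian Λ).eigenvalues₀ i) 0]
  · linarith [le_max_right (4 - (hamiltonian_isHermitian Λ).eigenvalues₀ i) 0]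

/-- The momentum distribution of the states with positive hopping eigenvalue. -/
noncomputable def momentumDensity (k : Fin 2 → ℝ) : ℝ :=
  ∑ j, if 0 < hopEigenvalue Λ j then ‖inner ℂ (eigenbasis Λ j) (waveVec Λ k)‖ ^ 2 else 0

/-- The energy deficit at momentum `k` of the electrons in `Λ` against a filled Fermi sea. -/
noncomputable def deficit (k : Fin 2 → ℝ) : ℝ :=
  Λ.card * max (hopSymbol k) 0 - hopSymbol k * momentumDensity Λ k

theorem continuous_momentumDensity : Continuous (momentumDensity Λ) := by
  refine continuous_finsetSum _ fun j _ => ?_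
  split_ifs
  · exact (continuous_inner_waveVec Λ _).norm.pow 2
  · exact continuous_const

theorem continuous_deficit : Continuous (deficit Λ) :=
  (continuous_const.mul continuous_max_hopSymbol).sub
    (continuous_hopSymbol.mul (continuous_momentumDensity Λ))

theorem integrableOn_brillouin {f : (Fin 2 → ℝ) → ℝ} (hf : Continuous f) :
    IntegrableOn f (brillouin 2) := by
  rw [brillouin_eq_rect]
  exact hf.continuousOn.integrableOn_compact (isCompact_rect ..)

theorem setIntegral_hopSymbol_mul_momentumDensity :
    ∫ k in brillouin 2, hopSymbol k * momentumDensity Λ k =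
      (2 * Real.pi) ^ 2 * ∑ j, max (hopEigenvalue Λ j) 0 := by
  simp only [momentumDensity, Finset.mul_sum]
  rw [integral_finsetSum]
  · refine Finset.sum_congr rfl fun j _ => ?_
    split_ifs with h
    · rw [setIntegral_hopSymbol_mul, hopping_eigenbasis, inner_smul_right,
        inner_self_eq_norm_sq_to_K, (eigenbasis Λ).orthonormal.1 j, max_eq_left h.le]
      simp
    · rw [max_eq_right (not_lt.1 h)]
      simp
  · intro j _
    refine integrableOn_brillouin (continuous_hopSymbol.mul ?_)
    split_ifs
    · exact (continuous_inner_waveVec Λ _).norm.pow 2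
    · exact continuous_const

/-- At half density the constants `4N` and `2|Λ|` cancel, leaving the difference of the two traces
of positive parts. -/
theorem energy_excess_ge {N : ℕ} (hN : (N : ℝ) = 1 / 2 * (Λ.card : ℝ)) :
    1 / (2 * Real.pi) ^ 2 * ∫ k in brillouin 2, deficit Λ k ≤
      groundEnergy Λ N - (Λ.card : ℝ) * energyPerSite 2 (1 / 2) := by
  have hP : (0 : ℝ) < (2 * Real.pi) ^ 2 := by positivity
  have hle : N ≤ Λ.card := by
    have h0 : (0 : ℝ) ≤ Λ.card := Nat.cast_nonneg _
    have : (N : ℝ) ≤ Λ.card := by linarith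
    exact_mod_cast this
  have h1 := groundEnergy_ge Λ hle
  have h2 := mul_le_mul_of_nonneg_left energyPerSite_half_le (Nat.cast_nonneg (α := ℝ) Λ.card)
  have h3 : ∫ k in brillouin 2, deficit Λ k =
      Λ.card * (∫ k in brillouin 2, max (hopSymbol k) 0) -
        (2 * Real.pi) ^ 2 * ∑ j, max (hopEigenvalue Λ j) 0 := by
    have i1 : IntegrableOn (fun k => (Λ.card : ℝ) * max (hopSymbol k) 0) (brillouin 2) :=
      integrableOn_brillouin (continuous_const.mul continuous_max_hopSymbol)
    have i2 : IntegrableOn (fun k => hopSymbol k * momentumDensity Λ k) (brillouin 2) :=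
      integrableOn_brillouin (continuous_hopSymbol.mul (continuous_momentumDensity Λ))
    simp only [deficit]
    rw [integral_sub i1 i2, integral_const_mul, setIntegral_hopSymbol_mul_momentumDensity]
  rw [h3, mul_sub, ← mul_assoc (1 / (2 * Real.pi) ^ 2) ((2 * Real.pi) ^ 2),
    one_div_mul_cancel hP.ne', one_mul]
  have h4 : (Λ.card : ℝ) * (2 - 1 / (2 * Real.pi) ^ 2 * ∫ k in brillouin 2, max (hopSymbol k) 0) =
      2 * Λ.card - 1 / (2 * Real.pi) ^ 2 *
        (Λ.card * ∫ k in brillouin 2, max (hopSymbol k) 0) := by ring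
  rw [h4] at h2
  linarith

/-- The sites of `Λ` without nearest neighbour in `Λ`. -/
def isolated : Finset (Fin 2 → ℤ) := Λ.filter fun x => ∀ e ∈ edges 2, x + e ∉ Λ

theorem eigenbasis_isolated {j : Λ} (hj : hopEigenvalue Λ j ≠ 0) {x : Λ}
    (hx : (x : Fin 2 → ℤ) ∈ isolated Λ) : eigenbasis Λ j x = 0 := by
  have h := congrFun (congrArg WithLp.ofLp (hopping_eigenbasis Λ j)) x
  have h0 : hopping Λ (eigenbasis Λ j) x = 0 := by
    simp only [hopping]
    refine Finset.sum_eq_zero fun e he => ?_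
    rw [dif_neg ((Finset.mem_filter.1 hx).2 e he)]
  rw [h0, PiLp.smul_apply, smul_eq_mul] at h
  exact (mul_eq_zero.1 h.symm).resolve_left (Complex.ofReal_ne_zero.2 hj)

/-- Removing the isolated sites from the plane wave leaves its overlaps with all eigenvectors with
`t_j ≠ 0` unchanged, since these vanish there. Parseval for the truncated wave, of squared norm
`|Λ|` minus the number of isolated sites, bounds the two weights. -/
theorem momentumDensity_add_le (k : Fin 2 → ℝ) :
    momentumDensity Λ k + (isolated Λ).card + (∑ j, if 1 * hopEigenvalue Λ j < 0 then
      ‖inner ℂ (eigenbasis Λ j) (waveVec Λ k)‖ ^ 2 else 0) ≤ Λ.card := by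
  set e' : EuclideanSpace ℂ Λ := WithLp.toLp 2 fun x =>
    if (x : Fin 2 → ℤ) ∈ isolated Λ then 0 else planeWave k x with he'
  have hin : ∀ j, hopEigenvalue Λ j ≠ 0 →
      inner ℂ (eigenbasis Λ j) (waveVec Λ k) = inner ℂ (eigenbasis Λ j) e' := by
    intro j hj
    simp only [PiLp.inner_apply, RCLike.inner_apply, waveVec, he']
    refine Finset.sum_congr rfl fun x _ => ?_
    split_ifs with hx
    · rw [eigenbasis_isolated Λ hj hx, map_zero, mul_zero, mul_zero]
    · rfl
  have hnorm : ‖e'‖ ^ 2 + (isolated Λ).card = Λ.card := by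
    have h1 : ‖e'‖ ^ 2 = ∑ x ∈ Λ, if x ∈ isolated Λ then (0 : ℝ) else 1 := by
      rw [EuclideanSpace.norm_sq_eq,
        ← Finset.sum_coe_sort Λ fun x => if x ∈ isolated Λ then (0 : ℝ) else 1]
      refine Finset.sum_congr rfl fun x _ => ?_
      simp only [he']
      split_ifs
      · simp
      · rw [norm_planeWave, one_pow]
    have h2 : ((isolated Λ).card : ℝ) = ∑ x ∈ Λ, if x ∈ isolated Λ then (1 : ℝ) else 0 := by
      rw [Finset.sum_ite_mem, Finset.inter_eq_right.2 (show isolated Λ ⊆ Λ from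
        Finset.filter_subset _ _)]
      simp
    have h3 : ((Λ.card : ℕ) : ℝ) = ∑ x ∈ Λ, (1 : ℝ) := by simp
    rw [h1, h2, h3, ← Finset.sum_add_distrib]
    refine Finset.sum_congr rfl fun x _ => ?_
    split_ifs <;> simp
  rw [← hnorm, ← (eigenbasis Λ).sum_sq_norm_inner_right, add_right_comm, momentumDensity,
    ← Finset.sum_add_distrib]
  refine add_le_add_left (Finset.sum_le_sum fun j _ => ?_) _
  have h0 := sq_nonneg ‖inner ℂ (eigenbasis Λ j) e'‖
  split_ifs with h1 h2 h2
  · linarith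
  · rw [hin j h1.ne']
    linarith
  · rw [hin j (by linarith)]
    linarith
  · linarith

theorem sum_nonneg_ite {ι : Type*} [Fintype ι] (p : ι → Prop) [DecidablePred p] (f : ι → ℝ) :
    0 ≤ ∑ j, if p j then f j ^ 2 else 0 :=
  Finset.sum_nonneg fun j _ => by
    split_ifs
    · positivity
    · exact le_rfl

theorem deficit_ge_of_pos {k : Fin 2 → ℝ} (hk : 0 ≤ hopSymbol k) :
    hopSymbol k * ((isolated Λ).card + ∑ j, if 1 * hopEigenvalue Λ j < 0 then
      ‖inner ℂ (eigenbasis Λ j) (waveVec Λ k)‖ ^ 2 else 0) ≤ deficit Λ k := by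
  rw [deficit, max_eq_left hk, mul_comm (Λ.card : ℝ), ← mul_sub]
  refine mul_le_mul_of_nonneg_left ?_ hk
  linarith [momentumDensity_add_le Λ k]

theorem deficit_eq_of_neg {k : Fin 2 → ℝ} (hk : hopSymbol k ≤ 0) :
    deficit Λ k = -hopSymbol k * ∑ j, if -1 * hopEigenvalue Λ j < 0 then
      ‖inner ℂ (eigenbasis Λ j) (waveVec Λ k)‖ ^ 2 else 0 := by
  rw [deficit, max_eq_right hk, momentumDensity]
  have : ∀ j, -1 * hopEigenvalue Λ j < 0 ↔ 0 < hopEigenvalue Λ j := fun j => by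
    constructor <;> intro h <;> linarith
  simp only [this]
  ring

theorem deficit_nonneg (k : Fin 2 → ℝ) : 0 ≤ deficit Λ k := by
  rcases le_total 0 (hopSymbol k) with hk | hk
  · exact (mul_nonneg hk (add_nonneg (Nat.cast_nonneg _) (sum_nonneg_ite _ _))).trans
      (deficit_ge_of_pos Λ hk)
  · rw [deficit_eq_of_neg Λ hk]
    exact mul_nonneg (neg_nonneg.2 hk) (sum_nonneg_ite _ _)

/-- The missing part of the hopping sum at `x`, relative to the phase of the plane wave. -/
noncomputable def missing (k : Fin 2 → ℝ) (x : Fin 2 → ℤ) : ℂ :=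
  ∑ e ∈ edges 2, if x + e ∈ Λ then 0 else planeWave k e

/-- The error of the plane wave as an eigenvector of the hopping operator. -/
noncomputable def errorVec (k : Fin 2 → ℝ) : EuclideanSpace ℂ Λ :=
  WithLp.toLp 2 fun x => planeWave k x * missing Λ k x

theorem hopping_waveVec (k : Fin 2 → ℝ) :
    hopping Λ (waveVec Λ k) = (hopSymbol k : ℂ) • waveVec Λ k - errorVec Λ k := by
  ext x
  simp only [hopping, waveVec, errorVec, missing, PiLp.sub_apply, PiLp.smul_apply, smul_eq_mul]
  rw [← sum_planeWave_edges, Finset.sum_mul, Finset.mul_sum, ← Finset.sum_sub_distrib]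
  refine Finset.sum_congr rfl fun e _ => ?_
  split_ifs
  · rw [planeWave_add]
    ring
  · ring

/-- The deficits at momenta on opposite sides of the Fermi surface are bounded below by the first
two moments of the hopping operator in the errors. -/
theorem deficit_add_deficit_ge {k k' : Fin 2 → ℝ} {m : ℝ} (hm : 0 ≤ m)
    (hk : m ≤ hopSymbol k) (hk8 : hopSymbol k ≤ 1 / 8)
    (hk' : hopSymbol k' ≤ -m) (hk8' : -(1 / 8) ≤ hopSymbol k') {X : ℝ}
    (hX : 144 * X ≤ ‖hopping Λ (errorVec Λ k)‖ ^ 2 / 4 + ‖hopping Λ (errorVec Λ k')‖ ^ 2 / 4 -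
      ((inner ℂ (errorVec Λ k) (hopping Λ (errorVec Λ k))).re -
        (inner ℂ (errorVec Λ k') (hopping Λ (errorVec Λ k'))).re)) :
    m * ((isolated Λ).card + X) ≤ deficit Λ k + deficit Λ k' := by
  have h1 := moments_le_spectral_weight (eigenbasis Λ) (hopEigenvalue Λ) (hopping Λ)
    (inner_eigenbasis_hopping Λ) (abs_hopEigenvalue_le Λ) (τ := hopSymbol k) (s := 1)
    (abs_le.2 ⟨by linarith, hk8⟩) (.inl rfl) (hopping_waveVec Λ k)
  have h2 := moments_le_spectral_weight (eigenbasis Λ) (hopEigenvalue Λ) (hopping Λ)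
    (inner_eigenbasis_hopping Λ) (abs_hopEigenvalue_le Λ) (τ := hopSymbol k') (s := -1)
    (abs_le.2 ⟨hk8', by linarith⟩) (.inr rfl) (hopping_waveVec Λ k')
  have h3 := deficit_ge_of_pos Λ (hm.trans hk)
  have h4 := deficit_eq_of_neg Λ (k := k') (by linarith)
  have n1 := sum_nonneg_ite (fun j => 1 * hopEigenvalue Λ j < 0)
    fun j => ‖inner ℂ (eigenbasis Λ j) (waveVec Λ k)‖
  have n2 := sum_nonneg_ite (fun j => -1 * hopEigenvalue Λ j < 0)
    fun j => ‖inner ℂ (eigenbasis Λ j) (waveVec Λ k')‖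
  set W := ∑ j, if 1 * hopEigenvalue Λ j < 0 then
    ‖inner ℂ (eigenbasis Λ j) (waveVec Λ k)‖ ^ 2 else 0
  set W' := ∑ j, if -1 * hopEigenvalue Λ j < 0 then
    ‖inner ℂ (eigenbasis Λ j) (waveVec Λ k')‖ ^ 2 else 0
  have h5 : X ≤ W + W' := by linarith
  have h6 : m * ((isolated Λ).card + W) ≤ deficit Λ k :=
    (mul_le_mul_of_nonneg_right hk (by positivity)).trans h3
  have h7 : m * W' ≤ deficit Λ k' := by
    rw [h4]
    exact mul_le_mul_of_nonneg_right (by linarith) n2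
  have h8 := mul_le_mul_of_nonneg_left h5 hm
  linarith

end Deficit

/-! ### Lower bounds on the error near the boundary. -/

section Local

variable (Λ : Finset (Fin 2 → ℤ))

/-- The boundary sites that have a nearest neighbour in `Λ`. -/
def edgeSites : Finset (Fin 2 → ℤ) := (boundary Λ).filter fun x => ∃ e ∈ edges 2, x + e ∈ Λ

theorem mem_edgeSites {x : Fin 2 → ℤ} : x ∈ edgeSites Λ ↔
    x ∈ Λ ∧ (∃ e ∈ edges 2, x + e ∉ Λ) ∧ ∃ e ∈ edges 2, x + e ∈ Λ := by
  simp [edgeSites, boundary, and_assoc]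

theorem card_boundary_le : (boundary Λ).card ≤ (isolated Λ).card + (edgeSites Λ).card := by
  refine (Finset.card_le_card fun x hx => ?_).trans (Finset.card_union_le _ _)
  by_cases h : ∃ e ∈ edges 2, x + e ∈ Λ
  · exact Finset.mem_union_right _ (Finset.mem_filter.2 ⟨hx, h⟩)
  · push Not at h
    exact Finset.mem_union_left _ (Finset.mem_filter.2 ⟨(Finset.mem_filter.1 hx).1, h⟩)

theorem missing_eq_zero {x : Fin 2 → ℤ} (hx : ∀ e ∈ edges 2, x + e ∈ Λ) (k : Fin 2 → ℝ) :
    missing Λ k x = 0 :=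
  Finset.sum_eq_zero fun e he => if_pos (hx e he)

theorem missing_of_isolated {x : Fin 2 → ℤ} (hx : ∀ e ∈ edges 2, x + e ∉ Λ) (k : Fin 2 → ℝ) :
    missing Λ k x = hopSymbol k := by
  rw [← sum_planeWave_edges]
  exact Finset.sum_congr rfl fun e he => if_neg (hx e he)

theorem card_edges_two : (edges 2).card = 4 := by decide

theorem norm_missing_le (k : Fin 2 → ℝ) (x : Fin 2 → ℤ) : ‖missing Λ k x‖ ≤ 4 := by
  refine (norm_sum_le_of_le (edges 2) (n := fun _ => (1 : ℝ)) fun e _ => ?_).trans ?_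
  · split_ifs
    · simp
    · rw [norm_planeWave]
  · simp [card_edges_two]

/-- The hopping operator applied to the error, relative to the phase of the plane wave. -/
noncomputable def missingHop (k : Fin 2 → ℝ) (x : Fin 2 → ℤ) : ℂ :=
  ∑ e ∈ edges 2, if x + e ∈ Λ then planeWave k e * missing Λ k (x + e) else 0

theorem hopping_errorVec (k : Fin 2 → ℝ) (x : Λ) :
    hopping Λ (errorVec Λ k) x = planeWave k x * missingHop Λ k x := by
  simp only [hopping, errorVec, missingHop, Finset.mul_sum]
  refine Finset.sum_congr rfl fun e _ => ?_
  split_ifs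
  · rw [planeWave_add, mul_assoc]
  · rw [mul_zero]

theorem norm_sq_hopping_errorVec (k : Fin 2 → ℝ) :
    ‖hopping Λ (errorVec Λ k)‖ ^ 2 = ∑ x ∈ Λ, ‖missingHop Λ k x‖ ^ 2 := by
  rw [EuclideanSpace.norm_sq_eq, ← Finset.sum_coe_sort Λ fun x => ‖missingHop Λ k x‖ ^ 2]
  refine Finset.sum_congr rfl fun x _ => ?_
  rw [hopping_errorVec, norm_mul, norm_planeWave, one_mul]

theorem inner_errorVec_hopping (k : Fin 2 → ℝ) :
    inner ℂ (errorVec Λ k) (hopping Λ (errorVec Λ k)) =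
      ∑ x ∈ Λ, (starRingEnd ℂ) (missing Λ k x) * missingHop Λ k x := by
  rw [PiLp.inner_apply,
    ← Finset.sum_coe_sort Λ fun x => (starRingEnd ℂ) (missing Λ k x) * missingHop Λ k x]
  refine Finset.sum_congr rfl fun x _ => ?_
  rw [RCLike.inner_apply, hopping_errorVec, errorVec]
  simp only [map_mul]
  linear_combination (starRingEnd ℂ) (missing Λ k x) * missingHop Λ k x *
    conj_planeWave_mul k x

/-- Both sides are `⟨e_k, T w⟩`, evaluated directly and by moving `T` onto `e_k`. Isolated sites
drop out because there the missing sum is `τ`, giving `τ² - τ² = 0`; interior sites have none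
missing. -/
theorem sum_missingHop (k : Fin 2 → ℝ) :
    ∑ x ∈ Λ, missingHop Λ k x =
      ∑ x ∈ edgeSites Λ, (hopSymbol k * missing Λ k x - (‖missing Λ k x‖ ^ 2 : ℝ)) := by
  have h1 : inner ℂ (waveVec Λ k) (hopping Λ (errorVec Λ k)) = ∑ x ∈ Λ, missingHop Λ k x := by
    rw [PiLp.inner_apply, ← Finset.sum_coe_sort Λ fun x => missingHop Λ k x]
    refine Finset.sum_congr rfl fun x _ => ?_
    rw [RCLike.inner_apply, hopping_errorVec, waveVec]
    linear_combination missingHop Λ k x * conj_planeWave_mul k x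
  have h2 : inner ℂ (waveVec Λ k) (hopping Λ (errorVec Λ k)) =
      ∑ x ∈ Λ, (hopSymbol k * missing Λ k x - (‖missing Λ k x‖ ^ 2 : ℝ)) := by
    rw [inner_hopping, hopping_waveVec, PiLp.inner_apply,
      ← Finset.sum_coe_sort Λ fun x =>
        ((hopSymbol k : ℂ) * missing Λ k x - ((‖missing Λ k x‖ ^ 2 : ℝ) : ℂ))]
    refine Finset.sum_congr rfl fun x _ => ?_
    rw [RCLike.inner_apply, PiLp.sub_apply, PiLp.smul_apply, waveVec, errorVec]
    push_cast
    rw [← Complex.conj_mul']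
    simp only [smul_eq_mul, map_sub, map_mul, Complex.conj_ofReal]
    linear_combination (hopSymbol k * missing Λ k x -
      (starRingEnd ℂ) (missing Λ k x) * missing Λ k x) * conj_planeWave_mul k x
  rw [← h1, h2]
  symm
  refine Finset.sum_subset (fun x hx => ((mem_edgeSites Λ).1 hx).1) fun x hx hx' => ?_
  rw [mem_edgeSites] at hx'
  by_cases h : ∃ e ∈ edges 2, x + e ∉ Λ
  · have h' : ∀ e ∈ edges 2, x + e ∉ Λ := fun e he hh => hx' ⟨hx, h, e, he, hh⟩
    rw [missing_of_isolated Λ h']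
    simp
    ring
  · push Not at h
    rw [missing_eq_zero Λ h]
    simp

/-- The sites of `Λ` next to a boundary site with a neighbour in `Λ`. -/
def nearEdge : Finset (Fin 2 → ℤ) := Λ.filter fun x => ∃ e ∈ edges 2, x + e ∈ edgeSites Λ

theorem card_nearEdge_le : (nearEdge Λ).card ≤ 4 * (edgeSites Λ).card := by
  have h : nearEdge Λ ⊆ (edgeSites Λ).biUnion fun y => (edges 2).image fun e => y - e := by
    intro x hx
    obtain ⟨-, e, he, hxe⟩ := Finset.mem_filter.1 hx
    exact Finset.mem_biUnion.2 ⟨x + e, hxe, Finset.mem_image.2 ⟨e, he, by simp⟩⟩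
  refine (Finset.card_le_card h).trans ((Finset.card_biUnion_le_card_mul _ _ 4 fun y _ =>
    Finset.card_image_le.trans card_edges_two.le).trans (by rw [mul_comm]))

theorem missingHop_eq_zero {x : Fin 2 → ℤ} (hx : x ∈ Λ) (hx' : x ∉ nearEdge Λ) (k : Fin 2 → ℝ) :
    missingHop Λ k x = 0 := by
  refine Finset.sum_eq_zero fun e he => ?_
  split_ifs with h
  · rw [missing_eq_zero, mul_zero]
    by_contra! hh
    refine hx' (Finset.mem_filter.2 ⟨hx, e, he, (mem_edgeSites Λ).2 ⟨h, hh, -e,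
      neg_mem_edges he, ?_⟩⟩)
    simpa using hx
  · rfl

/-- A linearised Cauchy–Schwarz inequality: `|z|² ≥ -(1/5) Re z - 1/100` is summed over the support
of `T w`, which has at most four sites per edge site, and `sum_missingHop` evaluates the linear
term. -/
theorem norm_sq_hopping_errorVec_ge (k : Fin 2 → ℝ) :
    1 / 5 * (∑ x ∈ edgeSites Λ, (‖missing Λ k x‖ ^ 2 - hopSymbol k * (missing Λ k x).re)) -
      1 / 25 * (edgeSites Λ).card ≤ ‖hopping Λ (errorVec Λ k)‖ ^ 2 := by
  have hsub : nearEdge Λ ⊆ Λ := Finset.filter_subset _ _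
  have h1 : ∑ x ∈ nearEdge Λ, ‖missingHop Λ k x‖ ^ 2 = ‖hopping Λ (errorVec Λ k)‖ ^ 2 := by
    rw [norm_sq_hopping_errorVec]
    exact Finset.sum_subset hsub fun x hx hx' => by
      rw [missingHop_eq_zero Λ hx hx', norm_zero, zero_pow two_ne_zero]
  have h2 : ∑ x ∈ nearEdge Λ, (missingHop Λ k x).re =
      -∑ x ∈ edgeSites Λ, (‖missing Λ k x‖ ^ 2 - hopSymbol k * (missing Λ k x).re) := by
    have h3 : ∑ x ∈ nearEdge Λ, missingHop Λ k x = ∑ x ∈ Λ, missingHop Λ k x :=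
      Finset.sum_subset hsub fun x hx hx' => missingHop_eq_zero Λ hx hx' k
    rw [← Complex.re_sum, h3, sum_missingHop, Complex.re_sum, ← Finset.sum_neg_distrib]
    refine Finset.sum_congr rfl fun x _ => ?_
    rw [Complex.sub_re, Complex.re_ofReal_mul, Complex.ofReal_re]
    ring
  have h4 : ∑ x ∈ nearEdge Λ, (-(1 / 5) * (missingHop Λ k x).re - 1 / 100) ≤
      ∑ x ∈ nearEdge Λ, ‖missingHop Λ k x‖ ^ 2 := by
    refine Finset.sum_le_sum fun x _ => ?_
    have h5 := neg_le_of_abs_le (Complex.abs_re_le_norm (missingHop Λ k x))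
    nlinarith [sq_nonneg (‖missingHop Λ k x‖ - 1 / 10)]
  rw [Finset.sum_sub_distrib, ← Finset.mul_sum, h2, h1, Finset.sum_const, nsmul_eq_mul] at h4
  have h6 : ((nearEdge Λ).card : ℝ) ≤ 4 * (edgeSites Λ).card := by
    exact_mod_cast card_nearEdge_le Λ
  linarith

theorem norm_planeWave_sub_le {k k' : Fin 2 → ℝ} (h0 : k 0 = k' 0) {e : Fin 2 → ℤ}
    (he : e ∈ edges 2) : ‖planeWave k e - planeWave k' e‖ ≤ |k 1 - k' 1| := by
  have h1 : planeWave k e = planeWave k' e *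
      Complex.exp (Complex.I * (((k 1 - k' 1) * e 1 : ℝ) : ℂ)) := by
    rw [planeWave, planeWave, ← Complex.exp_add, h0]
    congr 1
    push_cast
    ring
  have h2 : |(e 1 : ℝ)| ≤ 1 := by
    rw [edges_two] at he
    simp only [Finset.mem_insert, Finset.mem_singleton] at he
    rcases he with rfl | rfl | rfl | rfl <;> simp
  have h3 : planeWave k e - planeWave k' e = planeWave k' e *
      (Complex.exp (Complex.I * (((k 1 - k' 1) * e 1 : ℝ) : ℂ)) - 1) := by
    rw [h1]
    ring
  rw [h3, norm_mul, norm_planeWave, one_mul]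
  refine Real.norm_exp_I_mul_ofReal_sub_one_le.trans ?_
  rw [Real.norm_eq_abs, abs_mul]
  exact mul_le_of_le_one_right (abs_nonneg _) h2

theorem abs_hopSymbol_sub_le {k k' : Fin 2 → ℝ} (h0 : k 0 = k' 0) :
    |hopSymbol k - hopSymbol k'| ≤ 4 * |k 1 - k' 1| := by
  rw [← Real.norm_eq_abs, ← Complex.norm_real, Complex.ofReal_sub, ← sum_planeWave_edges,
    ← sum_planeWave_edges, ← Finset.sum_sub_distrib]
  refine (norm_sum_le_of_le (edges 2) fun e he => norm_planeWave_sub_le h0 he).trans ?_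
  simp [card_edges_two]

theorem norm_missing_sub_le {k k' : Fin 2 → ℝ} (h0 : k 0 = k' 0) (x : Fin 2 → ℤ) :
    ‖missing Λ k x - missing Λ k' x‖ ≤ 4 * |k 1 - k' 1| := by
  rw [missing, missing, ← Finset.sum_sub_distrib]
  refine (norm_sum_le_of_le (edges 2) (n := fun _ => |k 1 - k' 1|) fun e he => ?_).trans ?_
  · split_ifs
    · simp
    · exact norm_planeWave_sub_le h0 he
  · simp [card_edges_two]

theorem norm_mul_mul_sub_le {a b c a' b' c' : ℂ} {d : ℝ} (ha' : ‖a'‖ = 1)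
    (hb : ‖b‖ ≤ 4) (hc : ‖c‖ ≤ 4) (hb' : ‖b'‖ ≤ 4) (had : ‖a - a'‖ ≤ d)
    (hbd : ‖b - b'‖ ≤ 4 * d) (hcd : ‖c - c'‖ ≤ 4 * d) :
    ‖b * (a * c) - b' * (a' * c')‖ ≤ 48 * d := by
  have hd : 0 ≤ d := (norm_nonneg _).trans had
  have h : b * (a * c) - b' * (a' * c') =
      b * (a - a') * c + (b - b') * a' * c + b' * a' * (c - c') := by ring
  rw [h]
  refine (norm_add₃_le).trans ?_
  simp only [norm_mul, ha', mul_one]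
  have h1 : ‖b‖ * ‖a - a'‖ * ‖c‖ ≤ 4 * d * 4 := by gcongr
  have h2 : ‖b - b'‖ * ‖c‖ ≤ 4 * d * 4 := by gcongr
  have h3 : ‖b'‖ * ‖c - c'‖ ≤ 4 * (4 * d) := by gcongr
  linarith

/-- Only edge sites contribute, each with four directions and a product that is Lipschitz with
constant 48. This is what makes the indefinite moments at paired momenta cancel. -/
theorem norm_inner_errorVec_sub_le {k k' : Fin 2 → ℝ} (h0 : k 0 = k' 0) :
    ‖inner ℂ (errorVec Λ k) (hopping Λ (errorVec Λ k)) -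
      inner ℂ (errorVec Λ k') (hopping Λ (errorVec Λ k'))‖ ≤
      192 * |k 1 - k' 1| * (edgeSites Λ).card := by
  have h1 : ∀ k, inner ℂ (errorVec Λ k) (hopping Λ (errorVec Λ k)) =
      ∑ x ∈ edgeSites Λ, (starRingEnd ℂ) (missing Λ k x) * missingHop Λ k x := by
    intro k
    rw [inner_errorVec_hopping]
    symm
    refine Finset.sum_subset (fun x hx => ((mem_edgeSites Λ).1 hx).1) fun x hx hx' => ?_
    rw [mem_edgeSites] at hx'
    by_cases h : ∃ e ∈ edges 2, x + e ∉ Λ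
    · have h' : ∀ e ∈ edges 2, x + e ∉ Λ := fun e he hh => hx' ⟨hx, h, e, he, hh⟩
      rw [missingHop, Finset.sum_eq_zero fun e he => if_neg (h' e he), mul_zero]
    · push Not at h
      rw [missing_eq_zero Λ h, map_zero, zero_mul]
  rw [h1, h1, ← Finset.sum_sub_distrib]
  refine (norm_sum_le_of_le (edgeSites Λ) (n := fun _ => 192 * |k 1 - k' 1|)
    fun x _ => ?_).trans ?_
  · rw [missingHop, missingHop, Finset.mul_sum, Finset.mul_sum, ← Finset.sum_sub_distrib]
    refine (norm_sum_le_of_le (edges 2) (n := fun _ => 48 * |k 1 - k' 1|)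
      fun e he => ?_).trans ?_
    · split_ifs
      · refine norm_mul_mul_sub_le (norm_planeWave _ _) ?_ (norm_missing_le ..) ?_
          (norm_planeWave_sub_le h0 he) ?_ (norm_missing_sub_le Λ h0 _)
        · rw [RCLike.norm_conj]
          exact norm_missing_le ..
        · rw [RCLike.norm_conj]
          exact norm_missing_le ..
        · rw [← map_sub, RCLike.norm_conj]
          exact norm_missing_sub_le Λ h0 _
      · simp
    · rw [Finset.sum_const, card_edges_two]
      simp only [nsmul_eq_mul]
      push_cast
      linarith
  · rw [Finset.sum_const, nsmul_eq_mul]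
    linarith

theorem norm_sq_add_mul_exp_ge {θ : ℝ} (h1 : Real.pi / 6 ≤ θ) (h2 : θ ≤ Real.pi / 3) (a b : ℝ) :
    1 / 2 * (a ^ 2 + b ^ 2) ≤
      ‖(a : ℂ) * Complex.exp (Complex.I * θ) + b * Complex.exp (-(Complex.I * θ))‖ ^ 2 := by
  have hc : 1 / 2 ≤ Real.cos θ := by
    rw [← Real.cos_pi_div_three]
    exact Real.cos_le_cos_of_nonneg_of_le_pi (by linarith [Real.pi_pos])
      (by linarith [Real.pi_pos]) h2
  have hs : 1 / 2 ≤ Real.sin θ := by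
    rw [← Real.sin_pi_div_six]
    exact Real.sin_le_sin_of_le_of_le_pi_div_two (by linarith [Real.pi_pos])
      (by linarith [Real.pi_pos]) h1
  have h3 : (a : ℂ) * Complex.exp (Complex.I * θ) + b * Complex.exp (-(Complex.I * θ)) =
      (((a + b) * Real.cos θ : ℝ) : ℂ) + (((a - b) * Real.sin θ : ℝ) : ℂ) * Complex.I := by
    rw [mul_comm Complex.I, ← neg_mul, Complex.exp_mul_I, Complex.exp_mul_I, Complex.cos_neg,
      Complex.sin_neg]
    push_cast
    ring
  rw [h3, ← Complex.normSq_eq_norm_sq, Complex.normSq_add_mul_I, mul_pow, mul_pow]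
  have h4 : (1 : ℝ) / 4 ≤ Real.cos θ ^ 2 := by nlinarith
  have h5 : (1 : ℝ) / 4 ≤ Real.sin θ ^ 2 := by nlinarith
  nlinarith [mul_le_mul_of_nonneg_left h4 (sq_nonneg (a + b)),
    mul_le_mul_of_nonneg_left h5 (sq_nonneg (a - b))]

/-- The indicator of the missing neighbours of `x`. -/
def outside (x e : Fin 2 → ℤ) : ℝ := if x + e ∈ Λ then 0 else 1

theorem missing_eq_outside (k : Fin 2 → ℝ) (x : Fin 2 → ℤ) :
    missing Λ k x = ∑ e ∈ edges 2, (outside Λ x e : ℂ) * planeWave k e := by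
  refine Finset.sum_congr rfl fun e _ => ?_
  rw [outside]
  split_ifs <;> simp

theorem exp_I_mul_sub_pi (z : ℂ) :
    Complex.exp (Complex.I * (z - Real.pi)) = -Complex.exp (Complex.I * z) := by
  rw [mul_sub, Complex.exp_sub, mul_comm Complex.I (Real.pi : ℂ), Complex.exp_pi_mul_I, div_neg,
    div_one]

theorem exp_I_mul_pi_sub (z : ℂ) :
    Complex.exp (Complex.I * (Real.pi - z)) = -Complex.exp (-(Complex.I * z)) := by
  rw [← neg_sub, mul_neg, Complex.exp_neg, exp_I_mul_sub_pi, inv_neg, Complex.exp_neg]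

/-- On this Fermi line the phases of `(1, 0)` and `(0, -1)` are opposite, and so are those of `(-1,
0)` and `(0, 1)`: only the differences of the paired indicators survive, times `e^{iθ}` and
`e^{-iθ}`. The other line pairs the directions the other way. -/
theorem norm_sq_missing_fermi_ge {θ : ℝ} (h1 : Real.pi / 6 ≤ θ) (h2 : θ ≤ Real.pi / 3)
    (x : Fin 2 → ℤ) :
    1 / 2 * ((outside Λ x ![1, 0] - outside Λ x ![0, -1]) ^ 2 +
      (outside Λ x ![-1, 0] - outside Λ x ![0, 1]) ^ 2) ≤
        ‖missing Λ ![θ, 1 * (Real.pi - θ)] x‖ ^ 2 := by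
  refine (norm_sq_add_mul_exp_ge h1 h2 _ _).trans_eq ?_
  rw [missing_eq_outside, sum_edges_two]
  congr 2
  simp [planeWave]
  rw [exp_I_mul_pi_sub, exp_I_mul_sub_pi]
  ring

theorem norm_sq_missing_fermi_ge' {θ : ℝ} (h1 : Real.pi / 6 ≤ θ) (h2 : θ ≤ Real.pi / 3)
    (x : Fin 2 → ℤ) :
    1 / 2 * ((outside Λ x ![1, 0] - outside Λ x ![0, 1]) ^ 2 +
      (outside Λ x ![-1, 0] - outside Λ x ![0, -1]) ^ 2) ≤
        ‖missing Λ ![θ, -1 * (Real.pi - θ)] x‖ ^ 2 := by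
  refine (norm_sq_add_mul_exp_ge h1 h2 _ _).trans_eq ?_
  rw [missing_eq_outside, sum_edges_two]
  congr 2
  simp [planeWave]
  rw [exp_I_mul_pi_sub, exp_I_mul_sub_pi]
  ring

/-- The four differences run around a cycle through the four directions. At an edge site the
indicator is not constant, so it changes at least twice along the cycle. -/
theorem outside_sq_ge {x : Fin 2 → ℤ} (hx : x ∈ edgeSites Λ) :
    2 ≤ ((outside Λ x ![1, 0] - outside Λ x ![0, -1]) ^ 2 +
      (outside Λ x ![-1, 0] - outside Λ x ![0, 1]) ^ 2) +
      ((outside Λ x ![1, 0] - outside Λ x ![0, 1]) ^ 2 +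
      (outside Λ x ![-1, 0] - outside Λ x ![0, -1]) ^ 2) := by
  obtain ⟨-, h1, h2⟩ := (mem_edgeSites Λ).1 hx
  rw [edges_two] at h1 h2
  simp only [Finset.mem_insert, Finset.mem_singleton, exists_eq_or_imp, exists_eq_left] at h1 h2
  simp only [outside]
  split_ifs <;> first | (exfalso; tauto) | norm_num

/-- On one of the two Fermi lines `k₀ ± k₁ = π` the error has size of order one per boundary
site. -/
theorem exists_fermi_line : ∃ σ : ℝ, (σ = 1 ∨ σ = -1) ∧ ∀ θ, Real.pi / 6 ≤ θ → θ ≤ Real.pi / 3 →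
    1 / 2 * ((edgeSites Λ).card : ℝ) ≤
      ∑ x ∈ edgeSites Λ, ‖missing Λ ![θ, σ * (Real.pi - θ)] x‖ ^ 2 := by
  have h := Finset.sum_le_sum fun x hx => outside_sq_ge Λ (x := x) hx
  rw [Finset.sum_const, nsmul_eq_mul, Finset.sum_add_distrib] at h
  -- The two pairings sum to at least twice the number of edge sites, so one of them reaches that
  -- number. The choice does not depend on `θ`.
  by_cases h1 : ((edgeSites Λ).card : ℝ) ≤ ∑ x ∈ edgeSites Λ,
      ((outside Λ x ![1, 0] - outside Λ x ![0, -1]) ^ 2 +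
      (outside Λ x ![-1, 0] - outside Λ x ![0, 1]) ^ 2)
  · refine ⟨1, .inl rfl, fun θ h2 h3 => ?_⟩
    have h4 := Finset.sum_le_sum fun x (_ : x ∈ edgeSites Λ) =>
      norm_sq_missing_fermi_ge Λ h2 h3 x
    rw [← Finset.mul_sum] at h4
    linarith
  · refine ⟨-1, .inr rfl, fun θ h2 h3 => ?_⟩
    have h4 := Finset.sum_le_sum fun x (_ : x ∈ edgeSites Λ) =>
      norm_sq_missing_fermi_ge' Λ h2 h3 x
    rw [← Finset.mul_sum] at h4
    linarith

theorem hopSymbol_fermi {σ : ℝ} (hσ : σ = 1 ∨ σ = -1) (θ : ℝ) :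
    hopSymbol ![θ, σ * (Real.pi - θ)] = 0 := by
  rcases hσ with rfl | rfl <;> simp [hopSymbol, Real.cos_pi_sub, Real.cos_sub_pi]

theorem norm_sq_hopping_errorVec_ge_card {σ : ℝ} (hσ : σ = 1 ∨ σ = -1) {k : Fin 2 → ℝ}
    (hF : 1 / 2 * ((edgeSites Λ).card : ℝ) ≤
      ∑ x ∈ edgeSites Λ, ‖missing Λ ![k 0, σ * (Real.pi - k 0)] x‖ ^ 2)
    (hk : |k 1 - σ * (Real.pi - k 0)| ≤ 1 / 20000) :
    1 / 20 * ((edgeSites Λ).card : ℝ) ≤ ‖hopping Λ (errorVec Λ k)‖ ^ 2 := by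
  refine le_trans ?_ (norm_sq_hopping_errorVec_ge Λ k)
  set k₀ : Fin 2 → ℝ := ![k 0, σ * (Real.pi - k 0)] with hk₀
  have h0 : k 0 = k₀ 0 := rfl
  have hτ : |hopSymbol k| ≤ 4 * (1 / 20000) := by
    have := abs_hopSymbol_sub_le h0
    rw [hk₀, hopSymbol_fermi hσ, sub_zero] at this
    exact this.trans (mul_le_mul_of_nonneg_left hk (by norm_num))
  -- Leaving the Fermi line costs `32/20000` in the square and `16/20000` in the term with the
  -- symbol.
  have h1 : ∑ x ∈ edgeSites Λ, (‖missing Λ k₀ x‖ ^ 2 - 48 * (1 / 20000)) ≤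
      ∑ x ∈ edgeSites Λ, (‖missing Λ k x‖ ^ 2 - hopSymbol k * (missing Λ k x).re) := by
    refine Finset.sum_le_sum fun x _ => ?_
    have h2 : ‖missing Λ k x - missing Λ k₀ x‖ ≤ 4 * (1 / 20000) :=
      (norm_missing_sub_le Λ h0 x).trans (mul_le_mul_of_nonneg_left hk (by norm_num))
    have h3 := norm_missing_le Λ k x
    have h4 := norm_missing_le Λ k₀ x
    have h5 : ‖missing Λ k₀ x‖ - ‖missing Λ k x‖ ≤ 4 * (1 / 20000) :=
      (norm_sub_norm_le _ _).trans ((norm_sub_rev _ _).trans_le h2)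
    have h6 : hopSymbol k * (missing Λ k x).re ≤ 4 * (1 / 20000) * 4 :=
      (le_abs_self _).trans ((abs_mul _ _).trans_le (mul_le_mul hτ
        ((Complex.abs_re_le_norm _).trans h3) (abs_nonneg _) (by norm_num)))
    have h7 : ‖missing Λ k₀ x‖ ^ 2 - ‖missing Λ k x‖ ^ 2 ≤ 8 * (4 * (1 / 20000)) := by
      rw [sq_sub_sq]
      have := norm_nonneg (missing Λ k x)
      have := norm_nonneg (missing Λ k₀ x)
      exact mul_le_mul_of_nonneg (by linarith) h5 (by linarith) (by norm_num)
    linarith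
  rw [Finset.sum_sub_distrib, Finset.sum_const, nsmul_eq_mul] at h1
  have hM : (0 : ℝ) ≤ (edgeSites Λ).card := Nat.cast_nonneg _
  linarith

/-- The deficit on a pair of momenta on opposite sides of the Fermi surface. -/
theorem deficit_pair_ge {σ : ℝ} (hσ : σ = 1 ∨ σ = -1) {k k' : Fin 2 → ℝ} (h0 : k 0 = k' 0)
    (hF : 1 / 2 * ((edgeSites Λ).card : ℝ) ≤
      ∑ x ∈ edgeSites Λ, ‖missing Λ ![k 0, σ * (Real.pi - k 0)] x‖ ^ 2)
    (hk : |k 1 - σ * (Real.pi - k 0)| ≤ 1 / 20000)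
    (hk' : |k' 1 - σ * (Real.pi - k 0)| ≤ 1 / 20000)
    (hkk' : |k 1 - k' 1| ≤ 3 / 40000) {m : ℝ} (hm : 0 ≤ m)
    (hm1 : m ≤ hopSymbol k) (hm2 : hopSymbol k' ≤ -m) :
    m * ((isolated Λ).card + 1 / 14400 * (edgeSites Λ).card) ≤ deficit Λ k + deficit Λ k' := by
  have hM : (0 : ℝ) ≤ (edgeSites Λ).card := Nat.cast_nonneg _
  have hτ : ∀ p : Fin 2 → ℝ, p 0 = k 0 → |p 1 - σ * (Real.pi - k 0)| ≤ 1 / 20000 →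
      |hopSymbol p| ≤ 1 / 8 := by
    intro p hp hp1
    have := abs_hopSymbol_sub_le (k := p) (k' := ![k 0, σ * (Real.pi - k 0)]) hp
    rw [hopSymbol_fermi hσ, sub_zero] at this
    refine this.trans ((mul_le_mul_of_nonneg_left hp1 (by norm_num)).trans (by norm_num))
  have t1 := norm_sq_hopping_errorVec_ge_card Λ hσ hF hk
  have t2 := norm_sq_hopping_errorVec_ge_card Λ hσ (k := k') (by rw [← h0]; exact hF)
    (by rw [← h0]; exact hk')
  have t3 := (Complex.re_le_norm _).trans (norm_inner_errorVec_sub_le Λ h0)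
  rw [Complex.sub_re] at t3
  have t4 : 192 * |k 1 - k' 1| * ((edgeSites Λ).card : ℝ) ≤
      192 * (3 / 40000) * (edgeSites Λ).card := by gcongr
  -- Per edge site the second moments give `2 · (1/20)/4 = 0.025`, the first moments cost `192 ·
  -- 3/40000 = 0.0144`, and `144/14400 = 0.01` is required.
  refine deficit_add_deficit_ge Λ hm hm1 (abs_le.1 (hτ k rfl hk)).2 hm2
    (abs_le.1 (hτ k' h0.symm hk')).1 ?_
  linarith

end Local

/-! ### Integration over a strip along the Fermi line. -/

theorem cos_sub_cos_add_ge {x s : ℝ} (hx : Real.pi / 6 - 1 / 20000 ≤ x) (hx' : x ≤ Real.pi / 3)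
    (hs : 1 / 40000 ≤ s) (hs' : s ≤ 1 / 20000) :
    1 / 240000 ≤ Real.cos x - Real.cos (x + s) := by
  have hpi := Real.pi_gt_three
  have hpi' := Real.pi_lt_d2
  have h0 : Real.cos x - Real.cos (x + s) = 2 * Real.sin (x + s / 2) * Real.sin (s / 2) := by
    rw [Real.cos_sub_cos, show (x + (x + s)) / 2 = x + s / 2 by ring,
      show (x - (x + s)) / 2 = -(s / 2) by ring, Real.sin_neg]
    ring
  have h1 := Real.mul_le_sin (x := x + s / 2) (by linarith) (by linarith)
  have h2 := Real.mul_le_sin (x := s / 2) (by linarith) (by linarith)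
  have hq : (3 : ℝ) / 5 ≤ 2 / Real.pi := by
    rw [div_le_div_iff₀ (by norm_num) Real.pi_pos]
    linarith
  have h3 : (29 : ℝ) / 100 ≤ Real.sin (x + s / 2) := by
    refine le_trans ?_ h1
    have : (29 : ℝ) / 60 ≤ x + s / 2 := by linarith
    calc (29 : ℝ) / 100 = 3 / 5 * (29 / 60) := by norm_num
      _ ≤ _ := by gcongr
  have h4 : (3 : ℝ) / 400000 ≤ Real.sin (s / 2) := by
    refine le_trans ?_ h2
    have : (1 : ℝ) / 80000 ≤ s / 2 := by linarith
    calc (3 : ℝ) / 400000 = 3 / 5 * (1 / 80000) := by norm_num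
      _ ≤ _ := by gcongr
  rw [h0]
  calc (1 : ℝ) / 240000 ≤ 2 * (29 / 100) * (3 / 400000) := by norm_num
    _ ≤ _ := by gcongr

/-- A strip along the Fermi line `k₀ + σ k₁ = π`, on its inner side. -/
def fermiStrip (σ : ℝ) : Set (Fin 2 → ℝ) :=
  {k | (Real.pi / 6 ≤ k 0 ∧ k 0 ≤ Real.pi / 3) ∧
    1 / 40000 - Real.pi ≤ -k 0 - σ * k 1 ∧ -k 0 - σ * k 1 ≤ 1 / 20000 - Real.pi}

theorem measurableSet_fermiStrip (σ : ℝ) : MeasurableSet (fermiStrip σ) := by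
  have h1 : Measurable fun k : Fin 2 → ℝ => k 0 := measurable_pi_apply 0
  have h2 : Measurable fun k : Fin 2 → ℝ => -k 0 - σ * k 1 := by fun_prop
  exact ((measurableSet_le measurable_const h1).inter (measurableSet_le h1 measurable_const)).inter
    ((measurableSet_le measurable_const h2).inter (measurableSet_le h2 measurable_const))

theorem volume_real_fermiStrip {σ : ℝ} (hσ : σ = 1 ∨ σ = -1) :
    1 / 80000 ≤ volume.real (fermiStrip σ) := by
  -- A linear map of determinant `-σ = ±1` straightens the strip to a rectangle of sides `π/6` and
  -- `1/40000`.
  set f : (Fin 2 → ℝ) →ₗ[ℝ] (Fin 2 → ℝ) := Matrix.toLin' !![1, 0; -1, -σ] with hf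
  have hdet : LinearMap.det f = -σ := by
    rw [hf, LinearMap.det_toLin', Matrix.det_fin_two_of]
    ring
  have hne : LinearMap.det f ≠ 0 := by
    rw [hdet]
    rcases hσ with rfl | rfl <;> norm_num
  have hpre : fermiStrip σ =
      f ⁻¹' rect (Real.pi / 6) (Real.pi / 3) (1 / 40000 - Real.pi) (1 / 20000 - Real.pi) := by
    ext k
    have h0 : f k 0 = k 0 := by simp [hf, Matrix.toLin'_apply, Matrix.mulVec, dotProduct]
    have h1 : f k 1 = -k 0 - σ * k 1 := by
      simp [hf, Matrix.toLin'_apply, Matrix.mulVec, dotProduct]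
      ring
    change _ ↔ (_ ≤ f k 0 ∧ f k 0 ≤ _) ∧ (_ ≤ f k 1 ∧ f k 1 ≤ _)
    rw [h0, h1]
    rfl
  have habs : |(LinearMap.det f)⁻¹| = 1 := by
    rw [hdet]
    rcases hσ with rfl | rfl <;> norm_num
  rw [hpre, measureReal_def, Measure.addHaar_preimage_linearMap volume hne, habs,
    ENNReal.ofReal_one, one_mul, ← measureReal_def,
    volume_real_rect (by linarith [Real.pi_pos]) (by norm_num)]
  linarith [Real.pi_gt_three]

theorem deficit_fermiStrip_ge (Λ : Finset (Fin 2 → ℤ)) {σ : ℝ} (hσ : σ = 1 ∨ σ = -1)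
    (hF : ∀ θ, Real.pi / 6 ≤ θ → θ ≤ Real.pi / 3 → 1 / 2 * ((edgeSites Λ).card : ℝ) ≤
      ∑ x ∈ edgeSites Λ, ‖missing Λ ![θ, σ * (Real.pi - θ)] x‖ ^ 2)
    {k : Fin 2 → ℝ} (hk : k ∈ fermiStrip σ) :
    1 / 120000 * (1 / 14400 * ((boundary Λ).card : ℝ)) ≤
      deficit Λ k + deficit Λ (k + ![0, σ * (3 / 40000)]) := by
  obtain ⟨⟨h1, h2⟩, h3, h4⟩ := hk
  have hB : ((boundary Λ).card : ℝ) ≤ (isolated Λ).card + (edgeSites Λ).card := by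
    exact_mod_cast card_boundary_le Λ
  have hI : (0 : ℝ) ≤ (isolated Λ).card := Nat.cast_nonneg _
  -- The offset from the Fermi line: `s` lies in `[1/40000, 1/20000]`, and the shift by `3/40000`
  -- sends it to the mirror interval `[-1/20000, -1/40000]`, where the symbol is negative.
  obtain ⟨s, hs⟩ : ∃ s, s = Real.pi - k 0 - σ * k 1 := ⟨_, rfl⟩
  have hk1 : k 1 = σ * (Real.pi - k 0 - s) := by
    rw [hs]
    rcases hσ with rfl | rfl <;> ring
  set k' : Fin 2 → ℝ := k + ![0, σ * (3 / 40000)] with hk'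
  have hk'0 : k' 0 = k 0 := by
    rw [hk', Pi.add_apply, Matrix.cons_val_zero, add_zero]
  have hk'1 : k' 1 = σ * (Real.pi - k 0 - (s - 3 / 40000)) := by
    rw [hk', Pi.add_apply, hk1, Matrix.cons_val_one, Matrix.cons_val_fin_one]
    ring
  have habs : ∀ x : ℝ, |σ * x| = |x| := by
    intro x
    rcases hσ with rfl | rfl <;> simp
  have hcos : ∀ x : ℝ, Real.cos (σ * (Real.pi - k 0 - x)) = -Real.cos (k 0 + x) := by
    intro x
    rw [← Real.cos_pi_sub, sub_sub]
    rcases hσ with rfl | rfl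
    · rw [one_mul]
    · rw [neg_one_mul, Real.cos_neg]
  have hm1 : 1 / 120000 ≤ hopSymbol k := by
    have := cos_sub_cos_add_ge (x := k 0) (s := s) (by linarith) h2 (by linarith) (by linarith)
    rw [hopSymbol, hk1, hcos]
    linarith
  have hm2 : hopSymbol k' ≤ -(1 / 120000) := by
    have := cos_sub_cos_add_ge (x := k 0 + (s - 3 / 40000)) (s := 3 / 40000 - s) (by linarith)
      (by linarith) (by linarith) (by linarith)
    rw [show k 0 + (s - 3 / 40000) + (3 / 40000 - s) = k 0 by ring] at this
    rw [hopSymbol, hk'0, hk'1, hcos]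
    linarith
  refine le_trans ?_ (deficit_pair_ge Λ hσ hk'0.symm (hF _ h1 h2) ?_ ?_ ?_ (by norm_num) hm1 hm2)
  · refine mul_le_mul_of_nonneg_left ?_ (by norm_num)
    linarith
  · rw [hk1, ← mul_sub, habs, abs_le]
    constructor <;> linarith
  · rw [hk'1, ← mul_sub, habs, abs_le]
    constructor <;> linarith
  · rw [hk1, hk'1, ← mul_sub, habs, abs_le]
    constructor <;> linarith

theorem setIntegral_deficit_ge (Λ : Finset (Fin 2 → ℤ)) :
    1 / 80000 * (1 / 120000 * (1 / 14400 * ((boundary Λ).card : ℝ))) ≤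
      ∫ k in brillouin 2, deficit Λ k := by
  obtain ⟨σ, hσ, hF⟩ := exists_fermi_line Λ
  have hpi := Real.pi_gt_three
  set t : Fin 2 → ℝ := ![0, σ * (3 / 40000)] with ht
  have hσσ : σ * (σ * (3 / 40000)) = 3 / 40000 := by rcases hσ with rfl | rfl <;> norm_num
  -- The translated strip lies across the Fermi line, disjoint from the first. Hence the deficits of
  -- a pair add up under one integral over the strip.
  set R' : Set (Fin 2 → ℝ) := {k | k - t ∈ fermiStrip σ} with hR'
  have hmem : ∀ k ∈ R', (Real.pi / 6 ≤ k 0 ∧ k 0 ≤ Real.pi / 3) ∧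
      1 / 40000 - Real.pi - 3 / 40000 ≤ -k 0 - σ * k 1 ∧
      -k 0 - σ * k 1 ≤ 1 / 20000 - Real.pi - 3 / 40000 := by
    rintro k ⟨⟨h1, h2⟩, h3, h4⟩
    simp only [ht, Pi.sub_apply, Matrix.cons_val_zero, Matrix.cons_val_one, sub_zero, mul_sub,
      hσσ] at h1 h2 h3 h4
    exact ⟨⟨h1, h2⟩, by linarith, by linarith⟩
  have hR'm : MeasurableSet R' := (measurable_sub_const t) (measurableSet_fermiStrip σ)
  have hbox : ∀ k : Fin 2 → ℝ, Real.pi / 6 ≤ k 0 → k 0 ≤ Real.pi / 3 →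
      -(1 / 1000) - Real.pi ≤ -k 0 - σ * k 1 → -k 0 - σ * k 1 ≤ 1 / 1000 - Real.pi →
      k ∈ brillouin 2 := by
    intro k h1 h2 h3 h4
    rw [brillouin_eq_rect]
    refine ⟨⟨by linarith, by linarith⟩, ?_⟩
    rcases hσ with rfl | rfl
    · constructor <;> linarith
    · constructor <;> linarith
  have hsub : fermiStrip σ ∪ R' ⊆ brillouin 2 := by
    rintro k (hk | hk)
    · obtain ⟨⟨h1, h2⟩, h3, h4⟩ := hk
      exact hbox k h1 h2 (by linarith) (by linarith)
    · obtain ⟨⟨h1, h2⟩, h3, h4⟩ := hmem k hk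
      exact hbox k h1 h2 (by linarith) (by linarith)
  have hdisj : Disjoint (fermiStrip σ) R' := by
    rw [Set.disjoint_left]
    rintro k ⟨-, h3, -⟩ hk
    obtain ⟨-, -, h4⟩ := hmem k hk
    linarith
  have hint := integrableOn_brillouin (continuous_deficit Λ)
  have hint1 := hint.mono_set (Set.subset_union_left.trans hsub)
  have hint2 := hint.mono_set (Set.subset_union_right.trans hsub)
  have hpre : (fun k => k + t) ⁻¹' R' = fermiStrip σ := by
    ext k
    change k + t - t ∈ fermiStrip σ ↔ _
    rw [add_sub_cancel_right]
  have hmp := measurePreserving_add_right (volume : Measure (Fin 2 → ℝ)) t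
  have hemb := measurableEmbedding_addRight t
  have hshift : ∫ k in fermiStrip σ, deficit Λ (k + t) = ∫ k in R', deficit Λ k := by
    have := hmp.setIntegral_preimage_emb hemb (deficit Λ) R'
    rwa [hpre] at this
  have hint3 : IntegrableOn (fun k => deficit Λ (k + t)) (fermiStrip σ) := by
    have := (hmp.integrableOn_comp_preimage hemb (f := deficit Λ) (s := R')).2 hint2
    rwa [hpre] at this
  have h1 : ∫ k in fermiStrip σ ∪ R', deficit Λ k ≤ ∫ k in brillouin 2, deficit Λ k :=
    setIntegral_mono_set hint (Filter.Eventually.of_forall fun k => deficit_nonneg Λ k)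
      hsub.eventuallyLE
  rw [setIntegral_union hdisj hR'm hint1 hint2, ← hshift, ← integral_add hint1 hint3] at h1
  have hfin : volume (fermiStrip σ) ≠ ⊤ :=
    measure_ne_top_of_subset (Set.subset_union_left.trans hsub) volume_brillouin_ne_top
  have h2 : ∫ k in fermiStrip σ, (1 / 120000 * (1 / 14400 * ((boundary Λ).card : ℝ))) ≤
      ∫ k in fermiStrip σ, (deficit Λ k + deficit Λ (k + t)) :=
    setIntegral_mono_on (integrableOn_const hfin) (hint1.add hint3) (measurableSet_fermiStrip σ)
      fun k hk => deficit_fermiStrip_ge Λ hσ hF hk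
  rw [setIntegral_const, smul_eq_mul] at h2
  refine le_trans (mul_le_mul_of_nonneg_right (volume_real_fermiStrip hσ) (by positivity))
    (h2.trans h1)

end FalicovKimball

theorem mainTheorem2 :
    (∀ (Λ : Finset (Fin 2 → ℤ)) (N : ℕ), (N : ℝ) = 1 / 2 * (Λ.card : ℝ) →
      FalicovKimball.groundEnergy Λ N -
          (Λ.card : ℝ) * FalicovKimball.energyPerSite 2 (1 / 2) ≥
        ((FalicovKimball.boundary Λ).card : ℝ) / (2 * Real.pi) ^ 2 * (1 / (2 ^ 8 * 2 ^ 4)) *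
          min (∫ k in FalicovKimball.regionI, (2 * 2 - FalicovKimball.dispersion k))
            (∫ k in FalicovKimball.regionII, (2 * 2 - FalicovKimball.dispersion k))) ∧
    1 / (2 * Real.pi) ^ 2 * (1 / (2 ^ 8 * 2 ^ 4)) *
        min (∫ k in FalicovKimball.regionI, (2 * 2 - FalicovKimball.dispersion k))
          (∫ k in FalicovKimball.regionII, (2 * 2 - FalicovKimball.dispersion k)) >
      1 / (10 : ℝ) ^ 17 := by
  refine ⟨fun Λ N hN => ?_, FalicovKimball.coefficient_gt⟩
  refine le_trans ?_ (FalicovKimball.energy_excess_ge Λ hN)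
  have h1 := FalicovKimball.setIntegral_deficit_ge Λ
  have h2 := (min_le_right (∫ k in FalicovKimball.regionI, (2 * 2 - FalicovKimball.dispersion k))
    _).trans FalicovKimball.setIntegral_regionII_le
  have hB : (0 : ℝ) ≤ (FalicovKimball.boundary Λ).card := Nat.cast_nonneg _
  rw [div_mul_eq_mul_div, div_mul_eq_mul_div, one_div_mul_eq_div]
  gcongr
  refine le_trans ?_ h1
  refine le_trans (mul_le_mul_of_nonneg_left h2 (by positivity)) ?_
  -- The constants compare as `8 · 896⁻⁴ / 2¹²`, about `3.0 · 10⁻¹⁵`, against `1/(80000 · 120000 ·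
  -- 14400)`, about `7.2 · 10⁻¹⁵`.
  linarith
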